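/- Let $\Omega_1=\Omega_2=\{0,1\}^{\mathbb N}$ be two copies of the Cantor space; for a binary string $s$ let $[s]$ be the set of infinite sequences extending $s$. A probability measure $P$ on $\Omega_1\times\Omega_2$ is computable if the numbers $P([s]\times[t])$ are computable reals uniformly in the strings $s,t$. The conditional measure $P(\cdot\,|\,\alpha_1)$ is defined if $P([a]\times\Omega_2)>0$ for every prefix $a$ of $\alpha_1$ and there is a probability measure $P(\cdot\,|\,\alpha_1)$ on $\Omega_2$ with $$P([t]\,|\,\alpha_1)=\lim_{n\to\infty}\frac{P([a_n]\times[t])}{P([a_n]\times\Omega_2)}\quad\text{for every string }t,$$ where $a_n$ is the prefix of $\alpha_1$ of length $n$. A Martin-Löf test for a measure $\mu$ (with an oracle) is a sequence of sets $U_n$, effectively open uniformly in $n$ (with that oracle), with $\mu(U_n)\le 2^{-n}$. A point is $\mu$-random if it lies in $\bigcap_n U_n$ for no oracle-free Martin-Löf test for $\mu$ ($\mu$ computable). It is blind (Hippocratic) random relative to $\alpha_1$ for $\mu$, where $\mu$ need not be computable, if it lies in $\bigcap_n U_n$ for no Martin-Löf test for $\mu$ with oracle $\alpha_1$ (the tests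 have no access to $\mu$). A sequence is identified with the real in $[0,1]$ of which it is a binary expansion. By a Chaitin $\Omega$-number we mean a sequence that is Martin-Löf random for the uniform measure and whose real value is lower semicomputable, i.e. the limit of a computable nondecreasing sequence of binary fractions. **Theorem.** Chaitin $\Omega$-numbers exist, and for every Chaitin $\Omega$-number $\alpha_2\in\Omega_2$ there is a computable probability measure $P$ on $\Omega_1\times\Omega_2$ for which the conditional measure $P(\cdot\,|\,\alpha_1)$ is defined for all $\alpha_1\in\Omega_1$, and there is an $\alpha_1\in\Omega_1$ such that * the pair $(\alpha_1,\alpha_2)$ is $P$-random; * $P(\cdot\,|\,\alpha_1)$ is the uniform distribution on $[\alpha_2,1]$; * $\alpha_2$ is not blind random relative to $\alpha_1$ for $P(\cdot\,|\,\alpha_1)$. In particular there are a computable measure $P$ with $P(\cdot\,|\,\alpha_1)$ defined for all $\alpha_1$, and a $P$-random pair $(\alpha_1,\alpha_2)$, such that $\alpha_2$ is not blind random relative to $\alpha_1$ for $P(\cdot\,|\,\alpha_1)$. -/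

import Mathlib

open Set Filter Topology MeasureTheory

namespace CantorRandom

/-- The Cantor space of infinite binary sequences (with the product topology and its Borel
σ-algebra, which is the product σ-algebra). -/
abbrev Cantor : Type := ℕ → Bool

/-- The interval `[s]`: all infinite sequences that extend the finite string `s`. -/
def cyl (s : List Bool) : Set Cantor :=
  {x | ∀ i : Fin s.length, x i = s.get i}

/-- The rectangle `[s] × [t]` in the product of two Cantor spaces. -/
def rect (p : List Bool × List Bool) : Set (Cantor × Cantor) :=
  cyl p.1 ×ˢ cyl p.2

/-- The prefix of length `n` of an infinite sequence. -/
def pre (x : Cantor) (n : ℕ) : List Bool := (List.range n).map x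

/-- An infinite sequence used as an oracle: its characteristic function. -/
def oracle (x : Cantor) : ℕ →. ℕ := fun n => Part.some (x n).toNat

/-- The sets `U 0, U 1, …` are effectively open uniformly in `n`, with oracles `O`, with respect to
the indexed family `basic` of basic open sets: some partial function `f`, recursive in `O`, is such
that `U n` is the union of all basic sets `basic i` for which `f` halts on `(n, i)`. -/
def UniformlyEffectivelyOpenIn {ι X : Type} [Primcodable ι] (O : Set (ℕ →. ℕ))
    (basic : ι → Set X) (U : ℕ → Set X) : Prop :=
  ∃ f : ℕ × ι →. Unit, RecursiveIn O f ∧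
    ∀ n, U n = ⋃ i ∈ {i : ι | (f (n, i)).Dom}, basic i

/-- A Martin-Löf test with oracles `O` for the measure `μ`.  The oracles give no access to `μ`. -/
def IsMartinLofTestIn {ι X : Type} [Primcodable ι] [MeasurableSpace X] (O : Set (ℕ →. ℕ))
    (basic : ι → Set X) (μ : Measure X) (U : ℕ → Set X) : Prop :=
  UniformlyEffectivelyOpenIn O basic U ∧ ∀ n, μ (U n) ≤ 1 / 2 ^ n

/-- `x` passes all Martin-Löf tests with oracles `O` for `μ`.  When `μ` is computable (with the
oracles) this is Martin-Löf randomness (with the oracles); for an arbitrary `μ` this is blind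
(Hippocratic) randomness. -/
def PassesAllTestsIn {ι X : Type} [Primcodable ι] [MeasurableSpace X] (O : Set (ℕ →. ℕ))
    (basic : ι → Set X) (μ : Measure X) (x : X) : Prop :=
  ∀ U : ℕ → Set X, IsMartinLofTestIn O basic μ U → x ∉ ⋂ n, U n

/-- Martin-Löf randomness (without oracle) of a sequence; used for computable measures `μ`. -/
def MLRandom (μ : Measure Cantor) (x : Cantor) : Prop :=
  PassesAllTestsIn ∅ cyl μ x

/-- Martin-Löf randomness (without oracle) of a pair; used for computable measures `P`. -/
def MLRandomPair (P : Measure (Cantor × Cantor)) (z : Cantor × Cantor) : Prop :=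
  PassesAllTestsIn ∅ rect P z

/-- `x` is blind (Hippocratic) random with oracle `a` for the, possibly noncomputable, measure `μ`:
tests are enumerated with oracle `a` only. -/
def BlindRandomRel (a : Cantor) (μ : Measure Cantor) (x : Cantor) : Prop :=
  PassesAllTestsIn {oracle a} cyl μ x

/-- A measure on pairs is computable if the measures of the rectangles `[s] × [t]` are uniformly
computable reals: they can be approximated within `2⁻ᵏ` by a computable dyadic rational. -/
def ComputableMeasure (P : Measure (Cantor × Cantor)) : Prop :=
  ∃ q : (List Bool × List Bool) × ℕ → ℕ, Computable q ∧
    ∀ (p : List Bool × List Bool) (k : ℕ), |P.real (rect p) - (q (p, k) : ℝ) / 2 ^ k| ≤ 1 / 2 ^ k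

/-- The conditional measure `P(· | a)` is defined and equals `ν`: every prefix of `a` has positive
marginal probability, and for every string `t` the ratio `P([a₁] × [t]) / P([a₁] × Ω₂)` tends to
`ν [t]` as the length of the prefix `a₁` of `a` tends to infinity. -/
def IsConditionalMeasure (P : Measure (Cantor × Cantor)) (a : Cantor) (ν : Measure Cantor) :
    Prop :=
  IsProbabilityMeasure ν ∧
    (∀ n, P (cyl (pre a n) ×ˢ univ) ≠ 0) ∧
    ∀ t : List Bool,
      Tendsto (fun n => P (cyl (pre a n) ×ˢ cyl t) / P (cyl (pre a n) ×ˢ univ)) atTop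
        (𝓝 (ν (cyl t)))

/-- The uniform (fair coin) measure on the Cantor space. -/
noncomputable def fairCoin : Measure Cantor :=
  Measure.infinitePi fun _ : ℕ => (PMF.uniformOfFintype Bool).toMeasure

/-- The real number in `[0, 1]` with binary expansion `0.x₀x₁x₂…`. -/
noncomputable def value (x : Cantor) : ℝ :=
  ∑' n : ℕ, if x n then (1 / 2 : ℝ) ^ (n + 1) else 0

/-- The uniform distribution on `[r, 1]`, as a measure on binary expansions. -/
noncomputable def uniformAbove (r : ℝ) : Measure Cantor :=
  ProbabilityTheory.cond fairCoin {x | r ≤ value x}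

/-- The nonnegative real `r` is the limit of a computable nondecreasing sequence of binary
fractions. -/
def LowerSemicomputable (r : ℝ) : Prop :=
  ∃ p e : ℕ → ℕ, Computable p ∧ Computable e ∧
    Monotone (fun n => (p n : ℝ) / 2 ^ e n) ∧
    Tendsto (fun n => (p n : ℝ) / 2 ^ e n) atTop (𝓝 r)

/-- `w` is (the binary expansion of) a Chaitin Ω-number: a lower semicomputable real that is
Martin-Löf random with respect to the uniform measure. -/
def IsOmegaNumber (w : Cantor) : Prop :=
  LowerSemicomputable (value w) ∧ MLRandom fairCoin w

end CantorRandom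

open CantorRandom

/-! Let `r = value α₂`. Randomness excludes dyadic values, so `0 < r < 1`, and `r` is the limit of a
strictly increasing computable sequence of dyadic rationals `a k` with `a 0 = 0`. Draw `x` uniformly
and let the first coordinate record where `x` lies among the `a k`: `0ᵏ1` followed by independent
fair bits if `a k ≤ x < a (k + 1)`, all zeros if `x ≥ r`. Let `P` be the law of this code paired
with `x` (`jointMeasure`).

A prefix `0ⁿ` says exactly that `x ≥ a n`, and a prefix that contains a `1` involves only two of the
`a k`. Hence `P` is computable although `r` is not. Given `0ⁿ`, `x` is uniform on `[a n, 1]`; as `n`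
grows this tends to the uniform distribution on `[r, 1]`, the conditional measure at `zeros`. After
a first `1` the ratios are constant, because the fair bits cancel
(`isConditionalMeasure_condMeasure`).

The pair `(zeros, α₂)` is random: from a test for `P` keep the rectangles `[0ᵏ] × [t]`, cut down to
`x ≥ a k`; this is a test for the uniform measure that catches `α₂` whenever the original one
catches the pair (`mlRandomPair_jointMeasure`). Blind randomness fails because the sets `⋃ₖ [0, a k
+ 2⁻ⁿ)` are essentially effectively open, contain `α₂`, and meet `[r, 1]` only within `2⁻ⁿ` of `r`
(`not_blindRandomRel_uniformAbove`). No oracle is needed for this.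

An Ω-number is built directly, without a universal machine. A point moves right from `0`. When the
`e`-th program puts into its level `e + 2` an interval that contains the point or lies to its left,
the point moves to the right end of that interval, if necessary, provided that the moves for `e`
total at most `2⁻⁽ᵉ⁺²⁾`. All moves together amount to at most `1/2`. For a genuine test the moves
made for it are disjoint intervals inside a set of measure at most the budget, so the budget never
blocks one and the limit escapes the test (`exists_right_le_omegaApprox`). -/

namespace CantorRandom

/-! ### Binary strings, sequences and reals -/

/-- The natural number with binary expansion `t`, most significant digit first. -/
def bval (t : List Bool) : ℕ := t.foldl (fun n b => 2 * n + b.toNat) 0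

lemma bval_concat (t : List Bool) (b : Bool) : bval (t ++ [b]) = 2 * bval t + b.toNat := by
  simp [bval]

lemma bval_lt (t : List Bool) : bval t < 2 ^ t.length := by
  induction t using List.reverseRecOn with
  | nil => simp [bval]
  | append_singleton t b ih =>
    rw [bval_concat, List.length_append, List.length_singleton, pow_succ]
    have := b.toNat_le
    omega

lemma bval_injective {s t : List Bool} (hl : s.length = t.length) (h : bval s = bval t) :
    s = t := by
  induction s using List.reverseRecOn generalizing t with
  | nil => exact (List.length_eq_zero_iff.1 hl.symm).symm
  | append_singleton s b ih =>
    rcases List.eq_nil_or_concat t with rfl | ⟨t, c, rfl⟩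
    · simp at hl
    · simp only [List.concat_eq_append, List.length_append, List.length_singleton,
        Nat.add_right_cancel_iff, bval_concat] at hl h ⊢
      have hb := b.toNat_le
      have hc := c.toNat_le
      have hbc : b.toNat = c.toNat := by omega
      rw [ih hl (by omega), show b = c by revert hbc; cases b <;> cases c <;> simp]

@[simp] lemma length_pre (x : Cantor) (n : ℕ) : (pre x n).length = n := by simp [pre]

@[simp] lemma pre_zero (x : Cantor) : pre x 0 = [] := rfl

lemma pre_succ (x : Cantor) (n : ℕ) : pre x (n + 1) = pre x n ++ [x n] := by
  simp [pre, List.range_succ]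

lemma take_pre (x : Cantor) {m n : ℕ} (h : m ≤ n) : (pre x n).take m = pre x m := by
  simp [pre, ← List.map_take, List.take_range, h]

lemma mem_cyl_iff {x : Cantor} {t : List Bool} : x ∈ cyl t ↔ pre x t.length = t := by
  constructor
  · intro h
    refine List.ext_getElem (by simp) fun i h1 h2 => ?_
    simpa [pre] using h ⟨i, h2⟩
  · intro h i
    have := congrArg (fun l => l[(i : ℕ)]?) h
    simpa [pre] using this

lemma mem_cyl_pre {x y : Cantor} {n : ℕ} : y ∈ cyl (pre x n) ↔ ∀ i < n, y i = x i := by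
  simp [mem_cyl_iff, pre]

lemma self_mem_cyl_pre (x : Cantor) (n : ℕ) : x ∈ cyl (pre x n) :=
  mem_cyl_pre.2 fun _ _ => rfl

@[simp] lemma cyl_nil : cyl [] = univ := by
  ext x
  simp [mem_cyl_iff]

lemma mem_cyl_take {x : Cantor} {t : List Bool} (h : x ∈ cyl t) (m : ℕ) :
    x ∈ cyl (t.take m) := by
  rw [mem_cyl_iff] at h ⊢
  conv_rhs => rw [← h]
  rw [← take_pre x (show (t.take m).length ≤ t.length by simp), h, List.length_take]
  simp [List.take_eq_take_iff]

lemma measurableSet_cyl (t : List Bool) : MeasurableSet (cyl t) := by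
  have : cyl t = ⋂ i : Fin t.length, (fun x : Cantor => x i) ⁻¹' {t.get i} := by
    ext x
    simp [cyl]
  rw [this]
  exact MeasurableSet.iInter fun i => measurable_pi_apply _ (measurableSet_singleton _)

/-- The dyadic interval of reals whose expansions start with `t`. -/
def dyadicIco (t : List Bool) : Set ℝ :=
  Ico ((bval t : ℝ) / 2 ^ t.length) (((bval t : ℝ) + 1) / 2 ^ t.length)

lemma summable_digit (x : Cantor) :
    Summable fun n : ℕ => if x n then (1 / 2 : ℝ) ^ (n + 1) else 0 := by
  refine Summable.of_nonneg_of_le (fun n => ?_) (fun n => ?_)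
    ((summable_nat_add_iff 1).2 summable_geometric_two)
  · split_ifs <;> positivity
  · split_ifs
    · exact le_rfl
    · positivity

lemma sum_digit (x : Cantor) (n : ℕ) :
    ∑ i ∈ Finset.range n, (if x i then (1 / 2 : ℝ) ^ (i + 1) else 0) =
      (bval (pre x n) : ℝ) / 2 ^ n := by
  induction n with
  | zero => simp [bval]
  | succ n ih =>
    rw [Finset.sum_range_succ, ih, pre_succ, bval_concat]
    cases x n <;> simp [pow_succ] <;> field_simp

lemma le_value (x : Cantor) (n : ℕ) : (bval (pre x n) : ℝ) / 2 ^ n ≤ value x := by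
  rw [← sum_digit]
  exact (summable_digit x).sum_le_tsum _ fun i _ => by split_ifs <;> positivity

lemma value_le (x : Cantor) (n : ℕ) : value x ≤ ((bval (pre x n) : ℝ) + 1) / 2 ^ n := by
  rw [value, ← (summable_digit x).sum_add_tsum_nat_add n, sum_digit, add_div]
  gcongr
  have hs : Summable fun i : ℕ => (1 / 2 : ℝ) ^ i * (1 / 2) ^ (n + 1) :=
    summable_geometric_two.mul_right _
  calc _ ≤ ∑' i : ℕ, (1 / 2 : ℝ) ^ i * (1 / 2) ^ (n + 1) := by
        refine ((summable_nat_add_iff n).2 (summable_digit x)).tsum_le_tsum (fun i => ?_) hs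
        split_ifs
        · rw [← pow_add, add_assoc]
        · positivity
    _ = 1 / 2 ^ n := by
        rw [tsum_mul_right, tsum_geometric_two, pow_succ, one_div_pow]
        ring

lemma le_value_of_mem {x : Cantor} {t : List Bool} (h : x ∈ cyl t) :
    (bval t : ℝ) / 2 ^ t.length ≤ value x := by
  have := le_value x t.length
  rwa [mem_cyl_iff.1 h] at this

lemma value_le_of_mem {x : Cantor} {t : List Bool} (h : x ∈ cyl t) :
    value x ≤ ((bval t : ℝ) + 1) / 2 ^ t.length := by
  have := value_le x t.length
  rwa [mem_cyl_iff.1 h] at this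

lemma value_nonneg (x : Cantor) : 0 ≤ value x := by simpa [bval] using le_value x 0

lemma value_le_one (x : Cantor) : value x ≤ 1 := by simpa [bval] using value_le x 0

lemma measurable_value : Measurable value := by
  have h : ∀ n : ℕ, Measurable fun x : Cantor => (if x n then (1 / 2 : ℝ) ^ (n + 1) else 0) :=
    fun n => (Measurable.of_discrete (f := fun b : Bool =>
      if b then (1 / 2 : ℝ) ^ (n + 1) else 0)).comp (measurable_pi_apply n)
  exact measurable_of_tendsto_metrizable (fun n => Finset.measurable_sum (Finset.range n)
    fun i _ => h i) (tendsto_pi_nhds.2 fun x => by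
      simpa only [Finset.sum_apply, value] using (summable_digit x).hasSum.tendsto_sum_nat)

/-- The standard binary expansion of a real in `[0, 1)`. -/
noncomputable def bits (r : ℝ) : Cantor := fun n => decide (⌊2 ^ (n + 1) * r⌋₊ % 2 = 1)

lemma bval_pre_bits {r : ℝ} (h : r ∈ Ico (0 : ℝ) 1) (n : ℕ) :
    bval (pre (bits r) n) = ⌊2 ^ n * r⌋₊ := by
  induction n with
  | zero => simp [bval, (Nat.floor_eq_zero (R := ℝ)).2 h.2]
  | succ n ih =>
    rw [pre_succ, bval_concat, ih]
    have h2 : ⌊2 ^ n * r⌋₊ = ⌊2 ^ (n + 1) * r⌋₊ / 2 := by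
      have := Nat.floor_div_natCast (2 ^ (n + 1) * r) 2
      rw [← this]
      congr 1
      push_cast
      ring
    have h3 : (bits r n).toNat = ⌊2 ^ (n + 1) * r⌋₊ % 2 := by
      rcases Nat.mod_two_eq_zero_or_one ⌊2 ^ (n + 1) * r⌋₊ with h | h <;> simp [bits, h]
    omega

/-- Standard expansions fill half-open dyadic intervals exactly, while an arbitrary sequence only
satisfies the closed bounds `le_value` and `value_le`. -/
lemma bits_mem_cyl {r : ℝ} (h : r ∈ Ico (0 : ℝ) 1) {t : List Bool} :
    bits r ∈ cyl t ↔ r ∈ dyadicIco t := by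
  have hp : (0 : ℝ) < 2 ^ t.length := by positivity
  have h0 : 0 ≤ 2 ^ t.length * r := mul_nonneg hp.le h.1
  rw [mem_cyl_iff, dyadicIco, mem_Ico, div_le_iff₀ hp, lt_div_iff₀ hp, mul_comm r,
    ← Nat.floor_eq_iff h0, ← bval_pre_bits h]
  exact ⟨fun h => by rw [h], fun h => bval_injective (by simp) h⟩

lemma dyadicIco_subset (t : List Bool) : dyadicIco t ⊆ Ico 0 1 := by
  refine Ico_subset_Ico (by positivity) ?_
  rw [div_le_one (by positivity)]
  exact_mod_cast bval_lt t

lemma value_bits {r : ℝ} (h : r ∈ Ico (0 : ℝ) 1) : value (bits r) = r := by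
  refine eq_of_abs_sub_nonpos (ge_of_tendsto' (x := atTop) (f := fun n : ℕ => (1 / 2 : ℝ) ^ n)
    (tendsto_pow_atTop_nhds_zero_of_lt_one (by norm_num) (by norm_num)) fun n => ?_)
  have h1 := le_value (bits r) n
  have h2 := value_le (bits r) n
  obtain ⟨h3, h4⟩ := (bits_mem_cyl h).1 (self_mem_cyl_pre (bits r) n)
  rw [length_pre] at h3 h4
  rw [add_div] at h2 h4
  rw [one_div_pow, abs_le]
  constructor <;> linarith

lemma measurable_bits : Measurable bits := by
  refine measurable_pi_iff.2 fun n => ?_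
  exact (Measurable.of_discrete (f := fun m : ℕ => decide (m % 2 = 1))).comp
    (Nat.measurable_floor.comp (measurable_const.mul measurable_id))

/-! ### The fair-coin measure as the law of the binary digits of a uniform real -/

instance : IsProbabilityMeasure fairCoin := by
  unfold fairCoin
  infer_instance

lemma uniform_bool (b : Bool) :
    (PMF.uniformOfFintype Bool).toMeasure {b} = 1 / 2 := by
  rw [PMF.toMeasure_apply_singleton _ _ (measurableSet_singleton b)]
  simp

/-- The coordinates in a finite set are independent fair coins. -/
lemma fairCoin_pi (s : Finset ℕ) (x : Cantor) :
    fairCoin {y | ∀ i ∈ s, y i = x i} = (1 / 2) ^ s.card := by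
  have h := Measure.infinitePi_pi (fun _ : ℕ => (PMF.uniformOfFintype Bool).toMeasure)
    (s := s) (t := fun i => {x i}) fun i _ => measurableSet_singleton _
  simp only [uniform_bool, Finset.prod_const] at h
  rw [← h, fairCoin]
  congr 1

lemma fairCoin_cyl (t : List Bool) : fairCoin (cyl t) = (1 / 2) ^ t.length := by
  have h := fairCoin_pi (Finset.range t.length) fun i => t.getD i false
  rw [Finset.card_range] at h
  rw [← h]
  congr 1
  ext y
  simp only [cyl, mem_ofPred_eq, Finset.mem_range]
  constructor
  · intro h i hi
    simpa [hi] using h ⟨i, hi⟩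
  · intro h i
    simpa using h i i.2

lemma generateFrom_cyl :
    MeasurableSpace.generateFrom (insert ∅ (range cyl)) = MeasurableSpace.pi := by
  refine le_antisymm (MeasurableSpace.generateFrom_le ?_) ?_
  · rintro s (rfl | ⟨t, rfl⟩)
    · exact MeasurableSet.empty
    · exact measurableSet_cyl t
  · refine iSup_le fun i => ?_
    rintro _ ⟨B, -, rfl⟩
    have : (fun x : Cantor => x i) ⁻¹' B =
        ⋃ t ∈ {t : List Bool | t.length = i + 1 ∧ t.getD i false ∈ B}, cyl t := by
      ext x
      simp only [mem_preimage, mem_iUnion, mem_ofPred_eq, exists_prop]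
      constructor
      · intro hx
        exact ⟨pre x (i + 1), ⟨by simp, by simpa [pre] using hx⟩, self_mem_cyl_pre x _⟩
      · rintro ⟨t, ⟨ht, hB⟩, hx⟩
        have := hx ⟨i, by omega⟩
        simp only [List.get_eq_getElem] at this
        rw [this]
        simpa [show i < t.length by omega] using hB
    rw [this]
    exact MeasurableSet.biUnion (to_countable _) fun t _ =>
      MeasurableSpace.measurableSet_generateFrom (mem_insert_of_mem _ (mem_range_self t))

/-- Two cylinders that meet are nested. -/
lemma isPiSystem_cyl : IsPiSystem (insert ∅ (range cyl)) := by
  refine IsPiSystem.insert_empty ?_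
  have key : ∀ (s t : List Bool) (x : Cantor), x ∈ cyl s → x ∈ cyl t → s.length ≤ t.length →
      cyl t ⊆ cyl s := by
    intro s t x hs ht h y hy
    have := mem_cyl_take hy s.length
    rwa [← mem_cyl_iff.1 ht, take_pre x h, mem_cyl_iff.1 hs] at this
  rintro _ ⟨s, rfl⟩ _ ⟨t, rfl⟩ ⟨x, hs, ht⟩
  rcases le_total s.length t.length with h | h
  · exact ⟨t, (inter_eq_right.2 (key s t x hs ht h)).symm⟩
  · exact ⟨s, (inter_eq_left.2 (key t s x ht hs h)).symm⟩

lemma volume_dyadicIco (t : List Bool) : volume (dyadicIco t) = (1 / 2) ^ t.length := by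
  rw [dyadicIco, Real.volume_Ico, ← sub_div, add_sub_cancel_left, ← one_div_pow,
    ENNReal.ofReal_pow (by norm_num), ENNReal.ofReal_div_of_pos (by norm_num)]
  simp

lemma fairCoin_eq_map : fairCoin = (volume.restrict (Ico (0 : ℝ) 1)).map bits := by
  refine ext_of_generate_finite _ generateFrom_cyl.symm isPiSystem_cyl ?_ ?_
  · rintro _ (rfl | ⟨t, rfl⟩)
    · simp
    · have h : bits ⁻¹' cyl t ∩ Ico 0 1 = dyadicIco t := by
        ext r
        exact ⟨fun h => (bits_mem_cyl h.2).1 h.1, fun h =>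
          ⟨(bits_mem_cyl (dyadicIco_subset t h)).2 h, dyadicIco_subset t h⟩⟩
      rw [Measure.map_apply measurable_bits (measurableSet_cyl t),
        Measure.restrict_apply (measurable_bits (measurableSet_cyl t)), h, volume_dyadicIco,
        fairCoin_cyl]
  · rw [measure_univ, Measure.map_apply measurable_bits MeasurableSet.univ]
    simp

/-- Pulling back along `bits`, a section of `value` on `[0, 1)`, turns fair-coin computations into
lengths of intervals and avoids any discussion of double expansions. -/
lemma fairCoin_value_inter_cyl {J : Set ℝ} (hJ : MeasurableSet J) (t : List Bool) :
    fairCoin (value ⁻¹' J ∩ cyl t) = volume (J ∩ dyadicIco t) := by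
  have hm := (measurable_value hJ).inter (measurableSet_cyl t)
  have h : bits ⁻¹' (value ⁻¹' J ∩ cyl t) ∩ Ico 0 1 = J ∩ dyadicIco t := by
    ext r
    constructor
    · rintro ⟨⟨h1, h2⟩, h3⟩
      rw [mem_preimage, value_bits h3] at h1
      exact ⟨h1, (bits_mem_cyl h3).1 h2⟩
    · rintro ⟨h1, h2⟩
      have h3 := dyadicIco_subset t h2
      refine ⟨⟨?_, (bits_mem_cyl h3).2 h2⟩, h3⟩
      rwa [mem_preimage, value_bits h3]
  rw [fairCoin_eq_map, Measure.map_apply measurable_bits hm,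
    Measure.restrict_apply (measurable_bits hm), h]

lemma fairCoin_value {J : Set ℝ} (hJ : MeasurableSet J) :
    fairCoin (value ⁻¹' J) = volume (J ∩ Ico 0 1) := by
  simpa [dyadicIco, bval] using fairCoin_value_inter_cyl hJ []

/-! ### Computable unions of basic open sets as tests -/

lemma primrec_pow : Primrec₂ ((· ^ ·) : ℕ → ℕ → ℕ) := Primrec₂.unpaired'.1 Nat.Primrec.pow

lemma primrec_two_pow : Primrec fun n : ℕ => 2 ^ n := primrec_pow.comp (.const 2) .id

lemma primrec_bval : Primrec bval := by
  have h : Primrec₂ fun (_ : List Bool) (p : ℕ × Bool) => 2 * p.1 + p.2.toNat :=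
    Primrec.nat_add.comp (Primrec.nat_double.comp (Primrec.fst.comp Primrec.snd))
      ((Primrec.dom_finite Bool.toNat).comp (Primrec.snd.comp Primrec.snd))
  exact Primrec.list_foldl .id (.const 0) h

/-- Decidable families suffice for every test built below: witnesses that would otherwise be
searched for are coded in the length of the string. -/
lemma uniformlyEffectivelyOpenIn_of_computable {ι X : Type} [Primcodable ι] (O : Set (ℕ →. ℕ))
    (basic : ι → Set X) {p : ℕ × ι → Bool} (hp : Computable p) :
    UniformlyEffectivelyOpenIn O basic fun n => ⋃ i ∈ {i | p (n, i) = true}, basic i := by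
  have h : ComputablePred fun a => p a = true := ⟨inferInstance, by simpa using hp⟩
  refine ⟨_, Partrec.recursiveIn h.to_re, fun n => ?_⟩
  simp [Part.assert]

/-- Whether the string of a pair `(n, t)` has length `n + 1` and its closed dyadic interval contains
`A / 2 ^ l`. -/
def nearDyadic (A l : ℕ) (a : ℕ × List Bool) : Bool :=
  decide (a.2.length = a.1 + 1) && (decide (bval a.2 * 2 ^ l ≤ A * 2 ^ (a.1 + 1)) &&
    decide (A * 2 ^ (a.1 + 1) ≤ (bval a.2 + 1) * 2 ^ l))

lemma primrec_nearDyadic (A l : ℕ) : Primrec (nearDyadic A l) := by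
  have hn : Primrec fun a : ℕ × List Bool => a.1 + 1 := Primrec.succ.comp .fst
  have ht : Primrec fun a : ℕ × List Bool => bval a.2 := primrec_bval.comp .snd
  have hA : Primrec fun a : ℕ × List Bool => A * 2 ^ (a.1 + 1) :=
    Primrec.nat_mul.comp (.const A) (primrec_two_pow.comp hn)
  refine Primrec.and.comp (Primrec.eq.decide.comp (Primrec.list_length.comp .snd) hn)
    (Primrec.and.comp (Primrec.nat_le.decide.comp ?_ hA) (Primrec.nat_le.decide.comp hA ?_))
  · exact Primrec.nat_mul.comp ht (.const _)
  · exact Primrec.nat_mul.comp (Primrec.succ.comp ht) (.const _)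

lemma nearDyadic_iff {A l n : ℕ} {t : List Bool} : nearDyadic A l (n, t) = true ↔
    t.length = n + 1 ∧ (bval t : ℝ) / 2 ^ t.length ≤ A / 2 ^ l ∧
      (A : ℝ) / 2 ^ l ≤ (bval t + 1) / 2 ^ t.length := by
  simp only [nearDyadic, Bool.and_eq_true, decide_eq_true_eq]
  refine and_congr_right fun h => ?_
  rw [div_le_div_iff₀ (by positivity) (by positivity), div_le_div_iff₀ (by positivity)
    (by positivity), h]
  norm_cast

/-- Intervals of length `2⁻⁽ⁿ⁺¹⁾` that touch `d` stay within that distance of `d` on either side, so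
they cover measure at most `2⁻ⁿ`; this is why the strings have length `n + 1`. -/
lemma isMartinLofTestIn_nearDyadic (O : Set (ℕ →. ℕ)) (A l : ℕ) :
    IsMartinLofTestIn O cyl fairCoin
      fun n => ⋃ t ∈ {t | nearDyadic A l (n, t) = true}, cyl t := by
  refine ⟨uniformlyEffectivelyOpenIn_of_computable O cyl (primrec_nearDyadic A l).to_comp,
    fun n => ?_⟩
  set d : ℝ := A / 2 ^ l
  have hsub : (⋃ t ∈ {t | nearDyadic A l (n, t) = true}, cyl t) ⊆
      value ⁻¹' Icc (d - 1 / 2 ^ (n + 1)) (d + 1 / 2 ^ (n + 1)) := by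
    refine iUnion₂_subset fun t ht x hx => ?_
    obtain ⟨h1, h2, h3⟩ := nearDyadic_iff.1 ht
    have h4 := le_value_of_mem hx
    have h5 := value_le_of_mem hx
    rw [h1] at h2 h3 h4 h5
    rw [add_div] at h3 h5
    exact ⟨by linarith, by linarith⟩
  calc _ ≤ _ := measure_mono hsub
    _ = _ := fairCoin_value measurableSet_Icc
    _ ≤ volume (Icc (d - 1 / 2 ^ (n + 1)) (d + 1 / 2 ^ (n + 1))) := measure_mono inter_subset_left
    _ = ENNReal.ofReal (1 / 2 ^ n) := by
      rw [Real.volume_Icc]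
      congr 1
      rw [pow_succ]
      field_simp
      ring
    _ = 1 / 2 ^ n := by
      rw [ENNReal.ofReal_div_of_pos (by positivity), ENNReal.ofReal_pow (by norm_num)]
      simp

/-- A random sequence is not the expansion of a dyadic rational. -/
lemma MLRandom.value_ne {x : Cantor} (hx : MLRandom fairCoin x) (A l : ℕ) :
    value x ≠ A / 2 ^ l := by
  intro h
  refine hx _ (isMartinLofTestIn_nearDyadic ∅ A l) (mem_iInter.2 fun n => ?_)
  refine mem_iUnion₂.2 ⟨pre x (n + 1), nearDyadic_iff.2 ?_, self_mem_cyl_pre x _⟩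
  rw [length_pre, ← h]
  exact ⟨rfl, le_value x _, value_le x _⟩

/-! ### Existence of an Ω-number -/

open Nat.Partrec (Code)

/-- The index of the program considered at stage `s`. -/
def stageIndex (s : ℕ) : ℕ := s.unpair.1.unpair.1

/-- The string considered at stage `s`. -/
def stageString (s : ℕ) : List Bool := (Encodable.decode s.unpair.1.unpair.2).getD []

/-- The position reached after a history of moves: a pair `(e, d)` made at stage `s` is a move by
`d / 2 ^ s` on behalf of the `e`-th program, and the position after `s` stages is
`position L / 2 ^ s`. -/
def position (L : List (ℕ × ℕ)) : ℕ := L.foldr (fun p A => 2 * (A + p.2)) 0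

/-- The total length of the moves on behalf of the `e`-th program, on the scale of `position`. -/
def charge (e : ℕ) (L : List (ℕ × ℕ)) : ℕ :=
  L.foldr (fun p C => 2 * (C + if p.1 = e then p.2 else 0)) 0

/-- The move to the right end of the string considered at stage `s`. -/
def wantedMove (s : ℕ) (L : List (ℕ × ℕ)) : ℕ :=
  (bval (stageString s) + 1) * 2 ^ (s - (stageString s).length) - position L

/-- Whether at stage `s` the string considered is known to be in the level `e + 2` of the `e`-th
program, contains the current position or lies to its left, and the move is within the budget. -/
def moveAllowed (s : ℕ) (L : List (ℕ × ℕ)) : Bool :=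
  ((Code.evaln s (Denumerable.ofNat Code (stageIndex s))
    (Encodable.encode (stageIndex s + 2, stageString s))).isSome &&
    decide ((stageString s).length ≤ s)) &&
  (decide (bval (stageString s) * 2 ^ (s - (stageString s).length) ≤ position L) &&
    decide ((charge (stageIndex s) L + wantedMove s L) * 2 ^ (stageIndex s + 2) ≤ 2 ^ s))

/-- The history of the first `s` moves. -/
def history : ℕ → List (ℕ × ℕ)
  | 0 => []
  | s + 1 => (stageIndex s, bif moveAllowed s (history s) then wantedMove s (history s) else 0) ::
      history s

lemma primrec_stageIndex : Primrec stageIndex :=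
  Primrec.fst.comp (Primrec.unpair.comp (Primrec.fst.comp Primrec.unpair))

lemma primrec_stageString : Primrec stageString :=
  Primrec.option_getD.comp (Primrec.decode.comp
    (Primrec.snd.comp (Primrec.unpair.comp (Primrec.fst.comp Primrec.unpair)))) (.const [])

lemma primrec_position : Primrec position := by
  have h : Primrec₂ fun (_ : List (ℕ × ℕ)) (p : (ℕ × ℕ) × ℕ) => 2 * (p.2 + p.1.2) :=
    Primrec.nat_double.comp (Primrec.nat_add.comp (Primrec.snd.comp Primrec.snd)
      (Primrec.snd.comp (Primrec.fst.comp Primrec.snd)))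
  exact Primrec.list_foldr .id (.const 0) h

lemma primrec_charge : Primrec₂ charge := by
  have h : Primrec₂ fun (a : ℕ × List (ℕ × ℕ)) (p : (ℕ × ℕ) × ℕ) =>
      2 * (p.2 + if p.1.1 = a.1 then p.1.2 else 0) :=
    Primrec.nat_double.comp (Primrec.nat_add.comp (Primrec.snd.comp Primrec.snd)
      (Primrec.ite (Primrec.eq.comp (Primrec.fst.comp (Primrec.fst.comp Primrec.snd))
        (Primrec.fst.comp Primrec.fst)) (Primrec.snd.comp (Primrec.fst.comp Primrec.snd))
        (.const 0)))
  exact Primrec.list_foldr .snd (.const 0) h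

lemma primrec_wantedMove : Primrec₂ wantedMove := by
  have ht : Primrec fun a : ℕ × List (ℕ × ℕ) => stageString a.1 := primrec_stageString.comp .fst
  exact Primrec.nat_sub.comp (Primrec.nat_mul.comp (Primrec.succ.comp (primrec_bval.comp ht))
    (primrec_two_pow.comp (Primrec.nat_sub.comp .fst (Primrec.list_length.comp ht))))
    (primrec_position.comp .snd)

lemma primrec_moveAllowed : Primrec₂ moveAllowed := by
  have ht : Primrec fun a : ℕ × List (ℕ × ℕ) => stageString a.1 := primrec_stageString.comp .fst
  have he : Primrec fun a : ℕ × List (ℕ × ℕ) => stageIndex a.1 := primrec_stageIndex.comp .fst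
  have he2 : Primrec fun a : ℕ × List (ℕ × ℕ) => stageIndex a.1 + 2 :=
    Primrec.succ.comp (Primrec.succ.comp he)
  have hl := Primrec.list_length.comp ht
  have h1 := Primrec.option_isSome.comp (Code.primrec_evaln.comp
    ((Primrec.fst.pair ((Primrec.ofNat Code).comp he)).pair (Primrec.encode.comp (he2.pair ht))))
  have h2 := Primrec.nat_le.decide.comp hl Primrec.fst
  have h3 := Primrec.nat_le.decide.comp (Primrec.nat_mul.comp (primrec_bval.comp ht)
    (primrec_two_pow.comp (Primrec.nat_sub.comp .fst hl))) (primrec_position.comp .snd)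
  have h4 := Primrec.nat_le.decide.comp (Primrec.nat_mul.comp
    (Primrec.nat_add.comp (primrec_charge.comp he .snd) primrec_wantedMove)
    (primrec_two_pow.comp he2)) (primrec_two_pow.comp .fst)
  exact Primrec.and.comp (Primrec.and.comp h1 h2) (Primrec.and.comp h3 h4)

lemma primrec_history : Primrec history := by
  refine (Primrec.nat_rec₁ [] (f := fun s L => (stageIndex s,
    bif moveAllowed s L then wantedMove s L else 0) :: L) ?_).of_eq fun s => ?_
  · exact Primrec.list_cons.comp ((primrec_stageIndex.comp .fst).pair
      (Primrec.cond primrec_moveAllowed primrec_wantedMove (.const 0))) .snd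
  · induction s with
    | zero => rfl
    | succ s ih => rw [history, ← ih]

/-! ### Accounting of the moves as real numbers -/

/-- The position after `s` stages, as a real. -/
noncomputable def omegaApprox (s : ℕ) : ℝ := (position (history s) : ℝ) / 2 ^ s

/-- The total length of the moves made for the `e`-th program in the first `s` stages. -/
noncomputable def spent (e s : ℕ) : ℝ := (charge e (history s) : ℝ) / 2 ^ s

/-- The length of the move at stage `s`. -/
noncomputable def move (s : ℕ) : ℝ :=
  (bif moveAllowed s (history s) then (wantedMove s (history s) : ℝ) else 0) / 2 ^ s

lemma omegaApprox_succ (s : ℕ) : omegaApprox (s + 1) = omegaApprox s + move s := by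
  rw [omegaApprox, omegaApprox, move, history, position, List.foldr_cons, ← position, pow_succ]
  cases moveAllowed s (history s) <;> push_cast <;> simp <;> field_simp

lemma spent_succ (e s : ℕ) :
    spent e (s + 1) = spent e s + if stageIndex s = e then move s else 0 := by
  rw [spent, spent, move, history, charge, List.foldr_cons, ← charge, pow_succ]
  split_ifs <;> cases moveAllowed s (history s) <;> push_cast <;> simp <;> field_simp

lemma move_nonneg (s : ℕ) : 0 ≤ move s := by
  unfold move
  cases moveAllowed s (history s) <;> simp
  positivity

lemma omegaApprox_monotone : Monotone omegaApprox :=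
  monotone_nat_of_le_succ fun s => by
    rw [omegaApprox_succ]
    linarith [move_nonneg s]

lemma stageIndex_le (s : ℕ) : stageIndex s ≤ s :=
  (Nat.unpair_left_le _).trans (Nat.unpair_left_le s)

/-- Each move is charged to exactly one program, whose index does not exceed the stage. -/
lemma omegaApprox_eq_sum {s N : ℕ} (h : s ≤ N) :
    omegaApprox s = ∑ e ∈ Finset.range N, spent e s := by
  induction s with
  | zero => simp [omegaApprox, spent, history, position, charge]
  | succ s ih =>
    rw [omegaApprox_succ, ih (by omega)]
    simp_rw [spent_succ, Finset.sum_add_distrib]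
    rw [Finset.sum_ite_eq, if_pos (Finset.mem_range.2 (by have := stageIndex_le s; omega))]

lemma spent_le (e s : ℕ) : spent e s ≤ 1 / 2 ^ (e + 2) := by
  induction s with
  | zero => simp [spent, history, charge]
  | succ s ih =>
    rw [spent_succ]
    split_ifs with h
    · rw [move]
      cases hm : moveAllowed s (history s) with
      | false => simpa using ih
      | true =>
        simp only [moveAllowed, Bool.and_eq_true, decide_eq_true_eq] at hm
        have := hm.2.2
        rw [h] at this
        rw [spent, cond_true, ← add_div, div_le_div_iff₀ (by positivity) (by positivity), one_mul]
        exact_mod_cast this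
    · simpa using ih

lemma omegaApprox_le (s : ℕ) : omegaApprox s ≤ 1 / 2 := by
  rw [omegaApprox_eq_sum le_rfl]
  calc _ ≤ ∑ e ∈ Finset.range s, (1 / 2 : ℝ) ^ e * (1 / 4) :=
        Finset.sum_le_sum fun e _ => (spent_le e s).trans_eq (by
          rw [pow_add, one_div_pow]; field_simp; norm_num)
    _ ≤ 2 * (1 / 4) := by
        rw [← Finset.sum_mul]
        gcongr
        exact sum_geometric_two_le s
    _ = 1 / 2 := by norm_num

/-- The strings that the `e`-th program puts into its level `e + 2`. -/
def enumerated (e : ℕ) : Set (List Bool) :=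
  {t | ((Denumerable.ofNat Code e).eval (Encodable.encode (e + 2, t))).Dom}

/-- The set of reals covered by the level `e + 2` of the `e`-th program. -/
def region (e : ℕ) : Set ℝ := ⋃ t ∈ enumerated e, dyadicIco t

/-- A move of length `δ` inside `S` sweeps a new piece of `S`, disjoint from everything to its left.
-/
lemma volume_Iio_add_le {S : Set ℝ} {a δ : ℝ} (hδ : 0 ≤ δ) (h : Ico a (a + δ) ⊆ S) :
    volume (S ∩ Iio a) + ENNReal.ofReal δ ≤ volume (S ∩ Iio (a + δ)) := by
  have hv : volume (Ico a (a + δ)) = ENNReal.ofReal δ := by simp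
  rw [← hv, ← measure_union _ measurableSet_Ico]
  · refine measure_mono (union_subset (inter_subset_inter_right _ (Iio_subset_Iio (by linarith)))
      fun x hx => ⟨h hx, hx.2⟩)
  · exact disjoint_left.2 fun x hx hx' => absurd hx.2 (not_lt.2 hx'.1)

/-- The `max 0` reflects truncated subtraction: no move is wanted once the position has passed the
right end. -/
lemma wantedMove_div {s : ℕ} (h : (stageString s).length ≤ s) :
    (wantedMove s (history s) : ℝ) / 2 ^ s =
      max 0 (((bval (stageString s) : ℝ) + 1) / 2 ^ (stageString s).length - omegaApprox s) := by
  obtain ⟨k, hk⟩ := Nat.exists_eq_add_of_le h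
  have hr : ((bval (stageString s) : ℝ) + 1) / 2 ^ (stageString s).length =
      ((bval (stageString s) + 1) * 2 ^ (s - (stageString s).length) : ℕ) / 2 ^ s := by
    have h2 : (2 : ℝ) ^ s = 2 ^ (stageString s).length * 2 ^ k := by rw [← pow_add, ← hk]
    rw [show s - (stageString s).length = k by omega, h2]
    push_cast
    field_simp
  rw [wantedMove, omegaApprox, hr, ← sub_div]
  rcases le_total ((bval (stageString s) + 1) * 2 ^ (s - (stageString s).length))
    (position (history s)) with h | h
  · rw [Nat.sub_eq_zero_of_le h, max_eq_left]
    · simp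
    · exact div_nonpos_of_nonpos_of_nonneg (sub_nonpos.2 (by exact_mod_cast h)) (by positivity)
  · rw [Nat.cast_sub h, max_eq_right]
    exact div_nonneg (sub_nonneg.2 (by exact_mod_cast h)) (by positivity)

lemma left_le_iff {s : ℕ} (h : (stageString s).length ≤ s) :
    bval (stageString s) * 2 ^ (s - (stageString s).length) ≤ position (history s) ↔
      (bval (stageString s) : ℝ) / 2 ^ (stageString s).length ≤ omegaApprox s := by
  obtain ⟨k, hk⟩ := Nat.exists_eq_add_of_le h
  have hr : (bval (stageString s) : ℝ) / 2 ^ (stageString s).length =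
      (bval (stageString s) * 2 ^ (s - (stageString s).length) : ℕ) / 2 ^ s := by
    have h2 : (2 : ℝ) ^ s = 2 ^ (stageString s).length * 2 ^ k := by rw [← pow_add, ← hk]
    rw [show s - (stageString s).length = k by omega, h2]
    push_cast
    field_simp
  rw [hr, omegaApprox, div_le_div_iff_of_pos_right (by positivity), Nat.cast_le]

lemma Ico_wantedMove_subset {s : ℕ} (h : (stageString s).length ≤ s)
    (hl : (bval (stageString s) : ℝ) / 2 ^ (stageString s).length ≤ omegaApprox s) :
    Ico (omegaApprox s) (omegaApprox s + (wantedMove s (history s) : ℝ) / 2 ^ s) ⊆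
      dyadicIco (stageString s) := by
  rw [wantedMove_div h]
  rintro x ⟨h1, h2⟩
  refine ⟨hl.trans h1, ?_⟩
  rcases max_cases 0 (((bval (stageString s) : ℝ) + 1) / 2 ^ (stageString s).length -
    omegaApprox s) with h | h
  · linarith
  · linarith

/-- The moves for `e` are disjoint intervals in `region e`, all to the left of the current position.
-/
lemma spent_le_volume (e s : ℕ) :
    ENNReal.ofReal (spent e s) ≤ volume (region e ∩ Iio (omegaApprox s)) := by
  induction s with
  | zero => simp [spent, history, charge]
  | succ s ih =>
    rw [spent_succ, omegaApprox_succ]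
    split_ifs with he
    · refine ENNReal.ofReal_add_le.trans ((add_le_add_left ih _).trans ?_)
      refine volume_Iio_add_le (move_nonneg s) ?_
      rw [move]
      cases hm : moveAllowed s (history s) with
      | false => simp
      | true =>
        simp only [moveAllowed, Bool.and_eq_true, decide_eq_true_eq] at hm
        obtain ⟨⟨h1, h2⟩, h3, -⟩ := hm
        refine (Ico_wantedMove_subset h2 ((left_le_iff h2).1 h3)).trans ?_
        obtain ⟨x, hx⟩ := Option.isSome_iff_exists.1 h1
        rw [← he]
        exact subset_biUnion_of_mem (u := dyadicIco)
          (Part.dom_iff_mem.2 ⟨x, Code.evaln_sound hx⟩ : stageString s ∈ enumerated (stageIndex s))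
    · rw [add_zero]
      refine ih.trans (measure_mono (inter_subset_inter_right _ (Iio_subset_Iio ?_)))
      linarith [move_nonneg s]

/-- If the level `e + 2` of the `e`-th program is small, then the approximations do not stay in an
interval that belongs to it. -/
lemma exists_right_le_omegaApprox {e : ℕ} (he : volume (region e) ≤ 1 / 2 ^ (e + 2))
    {t : List Bool} (ht : t ∈ enumerated e) {s₀ : ℕ}
    (hs : (bval t : ℝ) / 2 ^ t.length ≤ omegaApprox s₀) :
    ∃ s, ((bval t : ℝ) + 1) / 2 ^ t.length ≤ omegaApprox s := by
  obtain ⟨x, hx⟩ := Part.dom_iff_mem.1 ht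
  obtain ⟨k, hk⟩ := Code.evaln_complete.1 hx
  -- The last component of the pairing is free, so `t` is considered for `e` at arbitrarily late
  -- stages: after `s₀`, with `t` expressible on the scale `2⁻ˢ`, and with enough steps for the
  -- program to halt.
  set s := Nat.pair (Nat.pair e (Encodable.encode t)) (max (max s₀ t.length) k) with hs_def
  have hms : max (max s₀ t.length) k ≤ s := Nat.right_le_pair _ _
  have hi : stageIndex s = e := by simp [stageIndex, hs_def]
  have hst : stageString s = t := by simp [stageString, hs_def]
  have hlen : (stageString s).length ≤ s := by rw [hst]; omega
  have hle : (bval (stageString s) : ℝ) / 2 ^ (stageString s).length ≤ omegaApprox s := by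
    rw [hst]
    exact hs.trans (omegaApprox_monotone (by omega))
  have hsub := Ico_wantedMove_subset hlen hle
  have hreg : dyadicIco (stageString s) ⊆ region e := by
    rw [hst]
    exact subset_biUnion_of_mem (u := dyadicIco) ht
  -- The past moves and the wanted one occupy disjoint parts of `region e`, whose volume is within
  -- the budget.
  have hbudget : spent e s + (wantedMove s (history s) : ℝ) / 2 ^ s ≤ 1 / 2 ^ (e + 2) := by
    have h0 : (0 : ℝ) ≤ 1 / 2 ^ (e + 2) := by positivity
    rw [← ENNReal.ofReal_le_ofReal_iff h0]
    refine ENNReal.ofReal_add_le.trans ((add_le_add_left (spent_le_volume e s) _).trans ?_)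
    refine (volume_Iio_add_le (by positivity) (hsub.trans hreg)).trans ?_
    refine (measure_mono inter_subset_left).trans (he.trans_eq ?_)
    rw [ENNReal.ofReal_div_of_pos (by positivity), ENNReal.ofReal_pow (by norm_num)]
    simp
  have hm : moveAllowed s (history s) = true := by
    simp only [moveAllowed, Bool.and_eq_true, decide_eq_true_eq]
    refine ⟨⟨?_, hlen⟩, (left_le_iff hlen).2 hle, ?_⟩
    · rw [hi, hst]
      exact Option.isSome_iff_exists.2 ⟨x, Code.evaln_mono (by omega) hk⟩
    · rw [hi]
      rw [spent, ← add_div, div_le_div_iff₀ (by positivity) (by positivity), one_mul] at hbudget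
      exact_mod_cast hbudget
  refine ⟨s + 1, ?_⟩
  rw [omegaApprox_succ, move, hm, cond_true, wantedMove_div hlen, hst]
  linarith [le_max_right 0 (((bval t : ℝ) + 1) / 2 ^ t.length - omegaApprox s)]

/-- Every enumerable family of sets of strings has an index `e` for which it agrees at `e + 2` with
the set enumerated by the `e`-th program. -/
lemma exists_index {p : ℕ × List Bool → Prop} (hp : REPred p)
    (hμ : ∀ n, fairCoin (⋃ t ∈ {t | p (n, t)}, cyl t) ≤ 1 / 2 ^ n) :
    ∃ e, (∀ t, t ∈ enumerated e ↔ p (e + 2, t)) ∧ volume (region e) ≤ 1 / 2 ^ (e + 2) := by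
  obtain ⟨c, hc⟩ := Code.exists_code.1 hp
  have h (t : List Bool) : t ∈ enumerated (Encodable.encode c) ↔ p (Encodable.encode c + 2, t) := by
    simp [enumerated, hc, Part.assert]
  refine ⟨Encodable.encode c, h, (le_of_eq ?_).trans (hμ _)⟩
  have hm : MeasurableSet (⋃ t ∈ {t | p (Encodable.encode c + 2, t)}, cyl t) :=
    MeasurableSet.biUnion (to_countable _) fun t _ => measurableSet_cyl t
  rw [fairCoin_eq_map, Measure.map_apply measurable_bits hm,
    Measure.restrict_apply (measurable_bits hm)]
  congr 1
  ext r
  simp only [region, h, mem_iUnion, mem_inter_iff, mem_preimage, exists_prop, mem_ofPred_eq]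
  constructor
  · rintro ⟨t, ht, hr⟩
    have h1 := dyadicIco_subset t hr
    exact ⟨⟨t, ht, (bits_mem_cyl h1).2 hr⟩, h1⟩
  · rintro ⟨⟨t, ht, hr⟩, h1⟩
    exact ⟨t, ht, (bits_mem_cyl h1).1 hr⟩

lemma exists_dyadic_of_pos {r : ℝ} (hr : r ∈ Ico (0 : ℝ) 1) (hpos : 0 < r) (n : ℕ) :
    ∃ t : List Bool, t.length = n ∧ (bval t : ℝ) / 2 ^ t.length < r ∧
      r ≤ ((bval t : ℝ) + 1) / 2 ^ t.length := by
  have hp : (0 : ℝ) < 2 ^ n := by positivity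
  obtain ⟨m, hm⟩ := Nat.exists_eq_succ_of_ne_zero (Nat.ceil_pos.2 (mul_pos hp hpos)).ne'
  have h1 : (m : ℝ) < 2 ^ n * r := by
    rw [← Nat.lt_ceil]
    omega
  have h2 : 2 ^ n * r ≤ m + 1 := by
    have := Nat.le_ceil (2 ^ n * r)
    rw [hm] at this
    exact_mod_cast this
  have hx : (m : ℝ) / 2 ^ n < r := by rwa [div_lt_iff₀' hp]
  have hb : bval (pre (bits (m / 2 ^ n)) n) = m := by
    rw [bval_pre_bits ⟨by positivity, hx.trans hr.2⟩, mul_div_cancel₀ _ hp.ne', Nat.floor_natCast]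
  refine ⟨pre (bits (m / 2 ^ n)) n, length_pre _ _, ?_⟩
  rw [length_pre, hb, le_div_iff₀' hp]
  exact ⟨hx, h2⟩

theorem exists_isOmegaNumber : ∃ w : Cantor, IsOmegaNumber w := by
  have hbdd : BddAbove (range omegaApprox) := ⟨1 / 2, by rintro _ ⟨s, rfl⟩; exact omegaApprox_le s⟩
  have hlim := tendsto_atTop_ciSup omegaApprox_monotone hbdd
  set r := ⨆ s, omegaApprox s
  have hle : ∀ s, omegaApprox s ≤ r := le_ciSup hbdd
  have hr : r ∈ Ico (0 : ℝ) 1 := by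
    refine ⟨(by simp [omegaApprox, history, position] : (0 : ℝ) ≤ omegaApprox 0).trans (hle 0), ?_⟩
    have := ciSup_le omegaApprox_le
    linarith
  refine ⟨bits r, ⟨fun s => position (history s), id,
    (primrec_position.comp primrec_history).to_comp, Computable.id, omegaApprox_monotone, ?_⟩, ?_⟩
  · rw [value_bits hr]
    exact hlim
  intro U hU hmem
  obtain ⟨⟨f, hf, hUf⟩, hμ⟩ := hU
  obtain ⟨e, he, hvol⟩ := exists_index (recursiveIn_empty_iff.1 hf).dom_re
    fun n => (hUf n).symm ▸ hμ n
  have hm := mem_iInter.1 hmem (e + 2)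
  rw [hUf] at hm
  obtain ⟨t, ht, hrt⟩ := mem_iUnion₂.1 hm
  rw [mem_ofPred_eq, ← he] at ht
  have hrt := (bits_mem_cyl hr).1 hrt
  by_cases hex : ∃ s, (bval t : ℝ) / 2 ^ t.length ≤ omegaApprox s
  · obtain ⟨s, hs⟩ := hex
    obtain ⟨s', hs'⟩ := exists_right_le_omegaApprox hvol ht hs
    exact absurd (hs'.trans (hle s')) (not_le.2 hrt.2)
  -- Remaining case: `r` is the left end of the interval of `t` and is approached strictly from
  -- below, so `t` never triggers a move. Then `r` is dyadic, and the test around this dyadic number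
  -- supplies an interval that starts strictly below `r` and ends at or above it; the move it forces
  -- reaches `r`, a contradiction.
  push Not at hex
  have hrd : r = (bval t : ℝ) / 2 ^ t.length := le_antisymm (ciSup_le fun s => (hex s).le) hrt.1
  have hpos : 0 < r := by
    have := hex 0
    rw [← hrd] at this
    exact lt_of_le_of_lt (by simp [omegaApprox, history, position]) this
  have hp : ComputablePred fun a => nearDyadic (bval t) t.length a = true :=
    ⟨inferInstance, by simpa using (primrec_nearDyadic _ _).to_comp⟩
  obtain ⟨e', he', hvol'⟩ := exists_index hp.to_re
    (isMartinLofTestIn_nearDyadic ∅ (bval t) t.length).2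
  obtain ⟨t', hlen, hl, hr'⟩ := exists_dyadic_of_pos hr hpos (e' + 2 + 1)
  have ht' : t' ∈ enumerated e' := by
    rw [he', nearDyadic_iff, ← hrd]
    exact ⟨hlen, hl.le, hr'⟩
  obtain ⟨s, hs⟩ := (hlim.eventually_const_lt hl).exists
  obtain ⟨s', hs'⟩ := exists_right_le_omegaApprox hvol' ht' hs.le
  have := hex s'
  rw [← hrd] at this
  linarith

/-! ### The joint measure -/

/-- A positive lower semicomputable real that is not dyadic is the limit of a strictly increasing
computable sequence of dyadic rationals that starts with `0`. -/
lemma LowerSemicomputable.exists_strictMono {r : ℝ} (hr : LowerSemicomputable r) (h0 : 0 < r) :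
    ∃ A E : ℕ → ℕ, Computable A ∧ Computable E ∧ A 0 = 0 ∧
      StrictMono (fun k => (A k : ℝ) / 2 ^ E k) ∧
      Tendsto (fun k => (A k : ℝ) / 2 ^ E k) atTop (𝓝 r) := by
  obtain ⟨p, e, hp, he, hmono, hlim⟩ := hr
  obtain ⟨N, hN⟩ := (hlim.eventually_const_lt h0).exists
  have hadd : Computable fun k : ℕ => k + N := (Primrec.nat_add.comp .id (.const N)).to_comp
  have heq (k : ℕ) : ((p (k + N) * (2 ^ k - 1) : ℕ) : ℝ) / 2 ^ (e (k + N) + k) =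
      (p (k + N) : ℝ) / 2 ^ e (k + N) * (1 - (1 / 2) ^ k) := by
    rw [Nat.cast_mul, Nat.cast_sub Nat.one_le_two_pow, pow_add, one_div_pow]
    push_cast
    field_simp
  -- The factor `1 - 2⁻ᵏ` makes the sequence start at `0` and increase strictly, the terms from `N`
  -- on being positive.
  refine ⟨fun k => p (k + N) * (2 ^ k - 1), fun k => e (k + N) + k, ?_, ?_, by simp, ?_, ?_⟩
  · exact Primrec.nat_mul.to_comp.comp (hp.comp hadd)
      (Primrec.nat_sub.comp primrec_two_pow (.const 1)).to_comp
  · exact Primrec.nat_add.to_comp.comp (he.comp hadd) Computable.id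
  · refine strictMono_nat_of_lt_succ fun k => ?_
    simp only [heq]
    have h1 : (p (k + N) : ℝ) / 2 ^ e (k + N) ≤ (p (k + 1 + N) : ℝ) / 2 ^ e (k + 1 + N) :=
      hmono (by omega)
    have h2 : 0 < (p (k + 1 + N) : ℝ) / 2 ^ e (k + 1 + N) :=
      hN.trans_le (hmono (by omega : N ≤ k + 1 + N))
    have h3 : (1 / 2 : ℝ) ^ (k + 1) < (1 / 2) ^ k :=
      pow_lt_pow_right_of_lt_one₀ (by norm_num) (by norm_num) (Nat.lt_succ_self k)
    have h4 : (1 / 2 : ℝ) ^ k ≤ 1 := pow_le_one₀ (by norm_num) (by norm_num)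
    exact (mul_le_mul_of_nonneg_right h1 (by linarith)).trans_lt
      (mul_lt_mul_of_pos_left (by linarith) h2)
  · simp only [heq]
    have h1 := hlim.comp (tendsto_add_atTop_nat N)
    have h2 : Tendsto (fun k : ℕ => 1 - (1 / 2 : ℝ) ^ k) atTop (𝓝 (1 - 0)) :=
      tendsto_const_nhds.sub
        (tendsto_pow_atTop_nhds_zero_of_lt_one (by norm_num) (by norm_num))
    simpa using! h1.mul h2

/-- The sequence `0ᵏ1` followed by digits of `y` when `value x` lies in `[a k, a (k + 1))`, and the
zero sequence when it lies above all `a k`. -/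
noncomputable def locate (a : ℕ → ℝ) (z : Cantor × Cantor) : Cantor := fun i =>
  if a (i + 1) ≤ value z.1 then false else if a i ≤ value z.1 then true else z.2 i

/-- The joint distribution of the location of `value x` among the `a k` and of `x`, for random
`x`. -/
noncomputable def jointMeasure (a : ℕ → ℝ) : Measure (Cantor × Cantor) :=
  (fairCoin.prod fairCoin).map fun z => (locate a z, z.1)

lemma measurable_locate (a : ℕ → ℝ) : Measurable (locate a) := by
  refine measurable_pi_iff.2 fun i => ?_
  have hv : Measurable fun z : Cantor × Cantor => value z.1 := measurable_value.comp measurable_fst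
  refine Measurable.ite (measurableSet_le measurable_const hv) measurable_const
    (Measurable.ite (measurableSet_le measurable_const hv) measurable_const ?_)
  exact (measurable_pi_apply i).comp measurable_snd

lemma measurable_locate_fst (a : ℕ → ℝ) :
    Measurable fun z : Cantor × Cantor => (locate a z, z.1) :=
  (measurable_locate a).prodMk measurable_fst

instance (a : ℕ → ℝ) : IsProbabilityMeasure (jointMeasure a) :=
  Measure.isProbabilityMeasure_map (measurable_locate_fst a).aemeasurable

section

variable {a : ℕ → ℝ} (ha : StrictMono a) (h0 : a 0 = 0)
include ha h0

lemma locate_eq_false_iff {z : Cantor × Cantor} {n : ℕ} :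
    (∀ i < n, locate a z i = false) ↔ a n ≤ value z.1 := by
  constructor
  · intro h
    induction n with
    | zero => exact h0 ▸ value_nonneg z.1
    | succ n ih =>
      have h1 := ih fun i hi => h i (by omega)
      have h2 := h n (by omega)
      by_contra h3
      simp [locate, h1, h3] at h2
  · intro h i hi
    simp [locate, (ha.monotone (by omega : i + 1 ≤ n)).trans h]

lemma jointMeasure_of_false {b : Cantor} {n : ℕ} (hb : ∀ i < n, b i = false) (t : List Bool) :
    jointMeasure a (cyl (pre b n) ×ˢ cyl t) = fairCoin (value ⁻¹' Ici (a n) ∩ cyl t) := by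
  rw [jointMeasure, Measure.map_apply (measurable_locate_fst a)
    ((measurableSet_cyl _).prod (measurableSet_cyl _))]
  have h : (fun z : Cantor × Cantor => (locate a z, z.1)) ⁻¹' (cyl (pre b n) ×ˢ cyl t) =
      (value ⁻¹' Ici (a n) ∩ cyl t) ×ˢ univ := by
    ext z
    simp only [mem_preimage, mem_prod, mem_cyl_pre, mem_inter_iff, mem_Ici, mem_univ, and_true]
    rw [← locate_eq_false_iff ha h0]
    exact and_congr_left fun _ => forall₂_congr fun i hi => by rw [hb i hi]
  rw [h, Measure.prod_prod, measure_univ, mul_one]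

/-- The digits after the first `1` are coins independent of `x`. They give every prefix positive
probability, and their factor does not depend on `t`. -/
lemma jointMeasure_of_true {b : Cantor} {k n : ℕ} (hkn : k < n) (hb : ∀ i < k, b i = false)
    (hk : b k = true) (t : List Bool) :
    jointMeasure a (cyl (pre b n) ×ˢ cyl t) =
      (1 / 2) ^ (n - (k + 1)) * fairCoin (value ⁻¹' Ico (a k) (a (k + 1)) ∩ cyl t) := by
  rw [jointMeasure, Measure.map_apply (measurable_locate_fst a)
    ((measurableSet_cyl _).prod (measurableSet_cyl _))]
  have h : (fun z : Cantor × Cantor => (locate a z, z.1)) ⁻¹' (cyl (pre b n) ×ˢ cyl t) =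
      (value ⁻¹' Ico (a k) (a (k + 1)) ∩ cyl t) ×ˢ
        {y | ∀ i ∈ Finset.Ico (k + 1) n, y i = b i} := by
    ext z
    simp only [mem_preimage, mem_prod, mem_cyl_pre, mem_inter_iff, mem_Ico, mem_ofPred_eq,
      Finset.mem_Ico]
    constructor
    · rintro ⟨h1, h2⟩
      have h3 : a k ≤ value z.1 := (locate_eq_false_iff ha h0).1 fun i hi =>
        (h1 i (by omega)).trans (hb i hi)
      have h4 : value z.1 < a (k + 1) := by
        by_contra h
        have := h1 k hkn
        simp [locate, hk, not_lt.1 h] at this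
      refine ⟨⟨⟨h3, h4⟩, h2⟩, fun i hi => ?_⟩
      have h5 := ha.monotone hi.1
      rw [← h1 i hi.2, locate, if_neg, if_neg]
      · exact not_le.2 (h4.trans_le h5)
      · exact not_le.2 (h4.trans_le (h5.trans (ha.monotone (Nat.le_succ i))))
    · rintro ⟨⟨⟨h3, h4⟩, h2⟩, h1⟩
      refine ⟨fun i hi => ?_, h2⟩
      rcases lt_trichotomy i k with hik | rfl | hik
      · rw [hb i hik]
        exact (locate_eq_false_iff ha h0).2 h3 i hik
      · simp [locate, h3, h4, hk]
      · have h5 := ha.monotone (show k + 1 ≤ i from hik)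
        rw [← h1 i ⟨hik, hi⟩, locate, if_neg, if_neg]
        · exact not_le.2 (h4.trans_le h5)
        · exact not_le.2 (h4.trans_le (h5.trans (ha.monotone (Nat.le_succ i))))
  rw [h, Measure.prod_prod, fairCoin_pi, Nat.card_Ico, mul_comm]

end

lemma fairCoin_Ico_ne_zero {u v : ℝ} (hu : 0 ≤ u) (huv : u < v) (hu1 : u < 1) :
    fairCoin (value ⁻¹' Ico u v) ≠ 0 := by
  rw [fairCoin_value measurableSet_Ico, Ico_inter_Ico, Real.volume_Ico, max_eq_left hu]
  simp [huv, hu1]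

lemma fairCoin_Ici {u : ℝ} (hu : 0 ≤ u) : fairCoin (value ⁻¹' Ici u) = ENNReal.ofReal (1 - u) := by
  rw [fairCoin_value measurableSet_Ici]
  have : Ici u ∩ Ico 0 1 = Ico u 1 := by
    ext x
    simp only [mem_inter_iff, mem_Ici, mem_Ico]
    exact ⟨fun h => ⟨h.1, h.2.2⟩, fun h => ⟨h.1, hu.trans h.1, h.2⟩⟩
  rw [this, Real.volume_Ico]

lemma uniformAbove_eq (r : ℝ) :
    uniformAbove r = ProbabilityTheory.cond fairCoin (value ⁻¹' Ici r) := rfl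

open Classical in
/-- The conditional distributions of `jointMeasure a`, where `r` is the limit of `a`. -/
noncomputable def condMeasure (a : ℕ → ℝ) (r : ℝ) (b : Cantor) : Measure Cantor :=
  if h : ∃ k, b k = true then
    ProbabilityTheory.cond fairCoin (value ⁻¹' Ico (a (Nat.find h)) (a (Nat.find h + 1)))
  else uniformAbove r

/-- If `b` has a first `1`, the ratio is constant beyond it. If `b` is zero, continuity from above
applies to `[r, ∞) = ⋂ₙ [a n, ∞)`, and the limiting denominator `1 - r` is positive. -/
lemma isConditionalMeasure_condMeasure {a : ℕ → ℝ} {r : ℝ} (ha : StrictMono a) (h0 : a 0 = 0)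
    (hlim : Tendsto a atTop (𝓝 r)) (hr : r < 1) (b : Cantor) :
    IsConditionalMeasure (jointMeasure a) b (condMeasure a r b) := by
  have hlt (k : ℕ) : a k < r :=
    (ha (Nat.lt_succ_self k)).trans_le (ha.monotone.ge_of_tendsto hlim (k + 1))
  have hnn (k : ℕ) : 0 ≤ a k := h0 ▸ ha.monotone (Nat.zero_le k)
  have hIci {u : ℝ} (hu : 0 ≤ u) (hu1 : u < 1) : fairCoin (value ⁻¹' Ici u) ≠ 0 := by
    rw [fairCoin_Ici hu]
    simpa using hu1
  have hIco (k : ℕ) : fairCoin (value ⁻¹' Ico (a k) (a (k + 1))) ≠ 0 :=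
    fairCoin_Ico_ne_zero (hnn k) (ha (Nat.lt_succ_self k)) ((hlt k).trans hr)
  by_cases h : ∃ k, b k = true
  · classical
    rw [condMeasure, dif_pos h]
    have hk := Nat.find_spec h
    have hmin : ∀ i < Nat.find h, b i = false := fun i hi => by simpa using Nat.find_min h hi
    generalize Nat.find h = k at hk hmin
    have hc (n : ℕ) : (1 / 2 : ENNReal) ^ n ≠ 0 ∧ (1 / 2 : ENNReal) ^ n ≠ ⊤ := by simp
    refine ⟨ProbabilityTheory.cond_isProbabilityMeasure (hIco k), fun n => ?_, fun t => ?_⟩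
    · rw [← cyl_nil]
      rcases lt_or_ge k n with hkn | hkn
      · rw [jointMeasure_of_true ha h0 hkn hmin hk, cyl_nil, inter_univ]
        exact mul_ne_zero (hc _).1 (hIco k)
      · rw [jointMeasure_of_false ha h0 (fun i hi => hmin i (by omega)), cyl_nil, inter_univ]
        exact hIci (hnn n) ((hlt n).trans hr)
    · refine tendsto_const_nhds.congr' ?_
      filter_upwards [eventually_gt_atTop k] with n hn
      rw [← cyl_nil, jointMeasure_of_true ha h0 hn hmin hk, jointMeasure_of_true ha h0 hn hmin hk,
        ENNReal.mul_div_mul_left _ _ (hc _).1 (hc _).2, cyl_nil, inter_univ,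
        ProbabilityTheory.cond_apply (measurable_value measurableSet_Ico), ENNReal.div_eq_inv_mul]
  · rw [condMeasure, dif_neg h]
    push Not at h
    have hb : ∀ i, b i = false := by simpa using h
    have hr0 : 0 ≤ r := (hnn 0).trans (hlt 0).le
    have hanti (t : List Bool) : Tendsto (fun n => fairCoin (value ⁻¹' Ici (a n) ∩ cyl t)) atTop
        (𝓝 (fairCoin (value ⁻¹' Ici r ∩ cyl t))) := by
      have : value ⁻¹' Ici r ∩ cyl t = ⋂ n, (value ⁻¹' Ici (a n) ∩ cyl t) := by
        ext x
        simp only [mem_inter_iff, mem_preimage, mem_Ici, mem_iInter]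
        exact ⟨fun h n => ⟨(hlt n).le.trans h.1, h.2⟩,
          fun h => ⟨le_of_tendsto' hlim fun n => (h n).1, (h 0).2⟩⟩
      rw [this]
      refine tendsto_measure_iInter_atTop (fun n => ((measurable_value measurableSet_Ici).inter
        (measurableSet_cyl t)).nullMeasurableSet) (fun m n hmn => ?_) ⟨0, measure_ne_top _ _⟩
      exact inter_subset_inter_left _ (preimage_mono (Ici_subset_Ici.2 (ha.monotone hmn)))
    refine ⟨ProbabilityTheory.cond_isProbabilityMeasure (hIci hr0 hr), fun n => ?_, fun t => ?_⟩
    · rw [← cyl_nil, jointMeasure_of_false ha h0 fun i _ => hb i, cyl_nil, inter_univ]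
      exact hIci (hnn n) ((hlt n).trans hr)
    · have hd := ENNReal.Tendsto.div (hanti t) (Or.inr (by
        rw [cyl_nil, inter_univ]; exact hIci hr0 hr)) (hanti []) (Or.inl (measure_ne_top _ _))
      simp only [cyl_nil, inter_univ] at hd
      rw [uniformAbove_eq, ProbabilityTheory.cond_apply (measurable_value measurableSet_Ici),
        ← ENNReal.div_eq_inv_mul]
      refine hd.congr fun n => ?_
      rw [← cyl_nil, jointMeasure_of_false ha h0 fun i _ => hb i,
        jointMeasure_of_false ha h0 fun i _ => hb i, cyl_nil, inter_univ]

/-! ### Computability of the joint measure -/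

/-- The numerator, over `2 ^ (t.length + E)`, of the uniform measure of the part of the interval of
`t` above `A / 2 ^ E`. -/
def tailNum (A E : ℕ) (t : List Bool) : ℕ :=
  (bval t + 1) * 2 ^ E - max (bval t * 2 ^ E) (A * 2 ^ t.length)

lemma fairCoin_real_Ici (A E : ℕ) (t : List Bool) :
    fairCoin.real (value ⁻¹' Ici ((A : ℝ) / 2 ^ E) ∩ cyl t) =
      tailNum A E t / 2 ^ (t.length + E) := by
  have h : Ici ((A : ℝ) / 2 ^ E) ∩ dyadicIco t =
      Ico (max ((bval t : ℝ) / 2 ^ t.length) (A / 2 ^ E)) ((bval t + 1) / 2 ^ t.length) := by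
    ext x
    simp only [dyadicIco, mem_inter_iff, mem_Ici, mem_Ico, max_le_iff]
    tauto
  have h1 : (bval t : ℝ) / 2 ^ t.length = (bval t * 2 ^ E : ℕ) / 2 ^ (t.length + E) := by
    push_cast; rw [pow_add]; field_simp
  have h2 : (A : ℝ) / 2 ^ E = (A * 2 ^ t.length : ℕ) / 2 ^ (t.length + E) := by
    push_cast; rw [pow_add]; field_simp
  have h3 : ((bval t : ℝ) + 1) / 2 ^ t.length =
      ((bval t + 1) * 2 ^ E : ℕ) / 2 ^ (t.length + E) := by
    push_cast; rw [pow_add]; field_simp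
  have hp : (0 : ℝ) < 2 ^ (t.length + E) := by positivity
  rw [Measure.real, fairCoin_value_inter_cyl measurableSet_Ici, h, Real.volume_Ico, h1, h2, h3,
    max_div_div_right hp.le, ← Nat.cast_max, ← sub_div, tailNum, ENNReal.toReal_ofReal']
  set u := (bval t + 1) * 2 ^ E
  set v := max (bval t * 2 ^ E) (A * 2 ^ t.length)
  rcases le_total u v with huv | huv
  · rw [Nat.sub_eq_zero_of_le huv, max_eq_right]
    · simp
    · exact div_nonpos_of_nonpos_of_nonneg (sub_nonpos.2 (by exact_mod_cast huv)) hp.le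
  · rw [Nat.cast_sub huv, max_eq_left]
    exact div_nonneg (sub_nonneg.2 (by exact_mod_cast huv)) hp.le

section

variable (A E : ℕ → ℕ)

/-- The position of the first `1` in the first string of a pair. -/
def firstOne (p : List Bool × List Bool) : ℕ := p.1.findIdx id

/-- The numerator of the joint measure of a rectangle. -/
def rectNum (p : List Bool × List Bool) : ℕ :=
  bif decide (firstOne p < p.1.length) then
    tailNum (A (firstOne p)) (E (firstOne p)) p.2 * 2 ^ E (firstOne p + 1) -
      tailNum (A (firstOne p + 1)) (E (firstOne p + 1)) p.2 * 2 ^ E (firstOne p)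
  else tailNum (A (firstOne p)) (E (firstOne p)) p.2

/-- The binary logarithm of the denominator of the joint measure of a rectangle. -/
def rectExp (p : List Bool × List Bool) : ℕ :=
  bif decide (firstOne p < p.1.length) then
    p.2.length + E (firstOne p) + E (firstOne p + 1) + (p.1.length - (firstOne p + 1))
  else p.2.length + E (firstOne p)

variable {A E}

lemma primrec_firstOne : Primrec firstOne := Primrec.list_findIdx .fst Primrec.snd

lemma primrec_tailNum : Primrec fun a : (ℕ × ℕ) × List Bool => tailNum a.1.1 a.1.2 a.2 := by
  have hE : Primrec fun a : (ℕ × ℕ) × List Bool => 2 ^ a.1.2 :=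
    primrec_two_pow.comp (Primrec.snd.comp .fst)
  have ht : Primrec fun a : (ℕ × ℕ) × List Bool => bval a.2 := primrec_bval.comp .snd
  exact Primrec.nat_sub.comp (Primrec.nat_mul.comp (Primrec.succ.comp ht) hE)
    (Primrec.nat_max.comp (Primrec.nat_mul.comp ht hE) (Primrec.nat_mul.comp
      (Primrec.fst.comp .fst) (primrec_two_pow.comp (Primrec.list_length.comp .snd))))

lemma primrec_hasOne :
    Primrec fun p : List Bool × List Bool => decide (firstOne p < p.1.length) :=
  Primrec.nat_lt.decide.comp primrec_firstOne (Primrec.list_length.comp .fst)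

lemma computable_rectNum (hA : Computable A) (hE : Computable E) : Computable (rectNum A E) := by
  have hk := primrec_firstOne.to_comp
  have hk1 := Computable.succ.comp hk
  have hG := primrec_tailNum.to_comp.comp (((hA.comp hk).pair (hE.comp hk)).pair Computable.snd)
  have hG1 := primrec_tailNum.to_comp.comp
    (((hA.comp hk1).pair (hE.comp hk1)).pair Computable.snd)
  have hmul := Primrec.nat_mul.to_comp
  have hpow := primrec_two_pow.to_comp
  exact Computable.cond primrec_hasOne.to_comp (Primrec.nat_sub.to_comp.comp
    (hmul.comp hG (hpow.comp (hE.comp hk1))) (hmul.comp hG1 (hpow.comp (hE.comp hk)))) hG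

lemma computable_rectExp (hE : Computable E) : Computable (rectExp E) := by
  have hk := primrec_firstOne.to_comp
  have hk1 := Computable.succ.comp hk
  have hadd := Primrec.nat_add.to_comp
  have hl := hadd.comp (Computable.list_length.comp Computable.snd) (hE.comp hk)
  exact Computable.cond primrec_hasOne.to_comp (hadd.comp (hadd.comp hl (hE.comp hk1))
    (Primrec.nat_sub.to_comp.comp (Computable.list_length.comp Computable.fst) hk1)) hl

lemma pre_getD (s : List Bool) : pre (fun i => s.getD i false) s.length = s := by
  refine List.ext_getElem (by simp) fun i h1 h2 => ?_
  simp [pre, h2]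

lemma jointMeasure_real_rect (h0 : A 0 = 0) (ha : StrictMono fun k => (A k : ℝ) / 2 ^ E k)
    (p : List Bool × List Bool) :
    (jointMeasure fun k => (A k : ℝ) / 2 ^ E k).real (rect p) =
      (rectNum A E p : ℝ) / 2 ^ rectExp E p := by
  obtain ⟨s, t⟩ := p
  have h0' : (A 0 : ℝ) / 2 ^ E 0 = 0 := by simp [h0]
  set k := s.findIdx id with hk
  have hmin : ∀ i < k, s.getD i false = false := by
    intro i hi
    have := List.not_of_lt_findIdx hi
    have hl : i < s.length := hi.trans_le List.findIdx_le_length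
    simpa [hl] using this
  rw [rect, Measure.real, rectNum, rectExp, firstOne]
  dsimp only
  rw [← hk]
  have hs := pre_getD s
  by_cases hks : k < s.length
  · have hone : s.getD k false = true := by
      have := List.findIdx_getElem (w := hks)
      simpa [hks] using this
    rw [decide_eq_true hks, cond_true, cond_true]
    conv_lhs => rw [← hs]
    rw [jointMeasure_of_true ha h0' hks hmin hone, ENNReal.toReal_mul]
    have hdiff : value ⁻¹' Ico ((A k : ℝ) / 2 ^ E k) ((A (k + 1) : ℝ) / 2 ^ E (k + 1)) ∩ cyl t =
        (value ⁻¹' Ici ((A k : ℝ) / 2 ^ E k) ∩ cyl t) \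
          (value ⁻¹' Ici ((A (k + 1) : ℝ) / 2 ^ E (k + 1)) ∩ cyl t) := by
      ext x
      simp only [mem_inter_iff, mem_preimage, mem_Ico, mem_Ici, Set.mem_sdiff, not_and_or, not_le]
      tauto
    have hsub : value ⁻¹' Ici ((A (k + 1) : ℝ) / 2 ^ E (k + 1)) ∩ cyl t ⊆
        value ⁻¹' Ici ((A k : ℝ) / 2 ^ E k) ∩ cyl t :=
      inter_subset_inter_left _ (preimage_mono (Ici_subset_Ici.2 (ha (Nat.lt_succ_self k)).le))
    have hreal := measureReal_sdiff (μ := fairCoin) hsub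
      ((measurable_value measurableSet_Ici).inter (measurableSet_cyl t))
    have hle := measureReal_mono (μ := fairCoin) hsub
    rw [fairCoin_real_Ici, fairCoin_real_Ici, div_le_div_iff₀ (by positivity) (by positivity),
      pow_add, pow_add] at hle
    -- Monotonicity of measure ensures that the natural-number subtraction in `rectNum` does not
    -- truncate.
    have hle' : tailNum (A (k + 1)) (E (k + 1)) t * 2 ^ E k ≤
        tailNum (A k) (E k) t * 2 ^ E (k + 1) := by
      have hp : (0 : ℝ) < 2 ^ t.length := by positivity
      rw [mul_left_comm, mul_left_comm _ (2 ^ t.length : ℝ), mul_le_mul_iff_right₀ hp] at hle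
      exact_mod_cast hle
    rw [← Measure.real, hdiff, hreal, fairCoin_real_Ici, fairCoin_real_Ici, Nat.cast_sub hle']
    push_cast
    simp only [pow_add, ENNReal.toReal_pow, ENNReal.toReal_div, ENNReal.toReal_one,
      ENNReal.toReal_ofNat, div_pow, one_pow]
    field_simp
  -- Without a `1` in `s`, `findIdx` returns the length, which is the index of the threshold needed
  -- for the prefix `0ᵏ`.
  · have hkl : k = s.length := le_antisymm List.findIdx_le_length (not_lt.1 hks)
    rw [decide_eq_false hks, cond_false, cond_false]
    conv_lhs => rw [← hs]
    rw [jointMeasure_of_false ha h0' (hkl ▸ hmin), ← hkl]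
    exact fairCoin_real_Ici _ _ _

lemma computableMeasure_jointMeasure (hA : Computable A) (hE : Computable E) (h0 : A 0 = 0)
    (ha : StrictMono fun k => (A k : ℝ) / 2 ^ E k) :
    ComputableMeasure (jointMeasure fun k => (A k : ℝ) / 2 ^ E k) := by
  have hpow := primrec_two_pow.to_comp
  refine ⟨fun a => rectNum A E a.1 * 2 ^ a.2 / 2 ^ rectExp E a.1,
    Primrec.nat_div.to_comp.comp (Primrec.nat_mul.to_comp.comp
      ((computable_rectNum hA hE).comp Computable.fst) (hpow.comp Computable.snd))
      (hpow.comp ((computable_rectExp hE).comp Computable.fst)), fun p k => ?_⟩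
  rw [jointMeasure_real_rect h0 ha]
  dsimp only
  set N := rectNum A E p
  set D := rectExp E p
  have hk : (0 : ℝ) < 2 ^ k := by positivity
  have hD : (0 : ℝ) < 2 ^ D := by positivity
  have h1 : ((N * 2 ^ k / 2 ^ D : ℕ) : ℝ) ≤ N / 2 ^ D * 2 ^ k := by
    refine Nat.cast_div_le.trans_eq ?_
    push_cast
    ring
  have h2 : (N : ℝ) / 2 ^ D * 2 ^ k < ((N * 2 ^ k / 2 ^ D : ℕ) : ℝ) + 1 := by
    have : N * 2 ^ k < (N * 2 ^ k / 2 ^ D + 1) * 2 ^ D := by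
      rw [mul_comm]
      have := Nat.lt_mul_div_succ (2 ^ k * N) (b := 2 ^ D) (by positivity)
      rw [mul_comm (2 ^ k)] at *
      linarith
    rw [div_mul_eq_mul_div, div_lt_iff₀ hD]
    exact_mod_cast this
  rw [abs_le]
  constructor
  · rw [← neg_div, div_le_iff₀ hk, sub_mul, div_mul_cancel₀ _ hk.ne']
    linarith
  · rw [le_div_iff₀ hk, sub_mul, div_mul_cancel₀ _ hk.ne']
    linarith

end

/-! ### Randomness of the pair and failure of blind randomness -/

/-- The zero sequence. -/
def zeros : Cantor := fun _ => false

lemma primrec_pre_zeros : Primrec (pre zeros) :=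
  Primrec.list_map Primrec.list_range (.const false)

/-- For a program `c` that enumerates pairs of strings, whether the string of `(n, t)`, whose length
encodes `(k, j, i)`, lies above the `k`-th dyadic rational and has a prefix of length `j` that is
enumerated within `i` steps together with the string of `k` zeros. -/
def sectionTest (c : Code) (A E : ℕ → ℕ) (a : ℕ × List Bool) : Bool :=
  (Code.evaln a.2.length.unpair.2.unpair.2 c (Encodable.encode
    (a.1, (pre zeros a.2.length.unpair.1, a.2.take a.2.length.unpair.2.unpair.1)))).isSome &&
  decide (A a.2.length.unpair.1 * 2 ^ a.2.length ≤ bval a.2 * 2 ^ E a.2.length.unpair.1)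

lemma computable_sectionTest (c : Code) {A E : ℕ → ℕ} (hA : Computable A) (hE : Computable E) :
    Computable (sectionTest c A E) := by
  have hl : Primrec fun a : ℕ × List Bool => a.2.length := Primrec.list_length.comp .snd
  have hk : Primrec fun a : ℕ × List Bool => a.2.length.unpair.1 :=
    Primrec.fst.comp (Primrec.unpair.comp hl)
  have hr : Primrec fun a : ℕ × List Bool => a.2.length.unpair.2.unpair :=
    Primrec.unpair.comp (Primrec.snd.comp (Primrec.unpair.comp hl))
  have h1 := Primrec.option_isSome.comp (Code.primrec_evaln.comp
    (((Primrec.snd.comp hr).pair (.const c)).pair (Primrec.encode.comp (Primrec.fst.pair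
      ((primrec_pre_zeros.comp hk).pair (Primrec.list_take.comp (Primrec.fst.comp hr) .snd))))))
  have hmul := Primrec.nat_mul.to_comp
  have hpow := primrec_two_pow.to_comp
  have h2 := Primrec.nat_le.decide.to_comp.comp
    (hmul.comp (hA.comp hk.to_comp) (hpow.comp hl.to_comp))
    (hmul.comp (primrec_bval.to_comp.comp Computable.snd) (hpow.comp (hE.comp hk.to_comp)))
  exact Primrec.and.to_comp.comp h1.to_comp h2

lemma sectionTest_iff {c : Code} {A E : ℕ → ℕ} {n : ℕ} {t : List Bool} :
    sectionTest c A E (n, t) = true ↔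
      (Code.evaln t.length.unpair.2.unpair.2 c (Encodable.encode
        (n, (pre zeros t.length.unpair.1, t.take t.length.unpair.2.unpair.1)))).isSome ∧
      (A t.length.unpair.1 : ℝ) / 2 ^ E t.length.unpair.1 ≤ (bval t : ℝ) / 2 ^ t.length := by
  simp only [sectionTest, Bool.and_eq_true, decide_eq_true_eq]
  rw [div_le_div_iff₀ (by positivity) (by positivity)]
  norm_cast

lemma mlRandomPair_jointMeasure {A E : ℕ → ℕ} (hA : Computable A) (hE : Computable E)
    (h0 : A 0 = 0) (ha : StrictMono fun k => (A k : ℝ) / 2 ^ E k) {x : Cantor}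
    (hlt : ∀ k, (A k : ℝ) / 2 ^ E k < value x) (hx : MLRandom fairCoin x) :
    MLRandomPair (jointMeasure fun k => (A k : ℝ) / 2 ^ E k) (zeros, x) := by
  intro U hU hmem
  obtain ⟨⟨f, hf, hUf⟩, hμ⟩ := hU
  obtain ⟨c, hc⟩ := Code.exists_code.1 (recursiveIn_empty_iff.1 hf)
  have hdom (a : ℕ × List Bool × List Bool) :
      (f a).Dom ↔ (c.eval (Encodable.encode a)).Dom := by
    simp [hc]
  have h0' : (A 0 : ℝ) / 2 ^ E 0 = 0 := by simp [h0]
  refine hx _ ⟨uniformlyEffectivelyOpenIn_of_computable ∅ cyl (computable_sectionTest c hA hE),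
    fun n => ?_⟩ (mem_iInter.2 fun n => ?_)
  · refine le_trans ?_ (hμ n)
    rw [jointMeasure]
    -- Every `y` in the new test set, with any auxiliary bits, is sent into `U n`: it lies above `a
    -- k`, so its code starts with `0ᵏ`.
    refine le_trans ?_ (Measure.le_map_apply (measurable_locate_fst _).aemeasurable _)
    set V := ⋃ t ∈ {t | sectionTest c A E (n, t) = true}, cyl t
    calc fairCoin V = (fairCoin.prod fairCoin) (V ×ˢ univ) := by
          rw [Measure.prod_prod, measure_univ, mul_one]
      _ ≤ _ := measure_mono ?_
    rintro ⟨y, z⟩ ⟨hy, -⟩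
    obtain ⟨t, ht, hyt⟩ := mem_iUnion₂.1 hy
    obtain ⟨h1, h2⟩ := sectionTest_iff.1 ht
    obtain ⟨v, hv⟩ := Option.isSome_iff_exists.1 h1
    rw [mem_preimage, hUf]
    refine mem_iUnion₂.2 ⟨_, (hdom _).2 (Part.dom_iff_mem.2 ⟨v, Code.evaln_sound hv⟩), ?_⟩
    refine ⟨mem_cyl_pre.2 ?_, mem_cyl_take hyt _⟩
    exact (locate_eq_false_iff ha h0').2 (h2.trans (le_value_of_mem hyt))
  · have hm := mem_iInter.1 hmem n
    rw [hUf] at hm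
    obtain ⟨⟨s, t⟩, hst, hs, ht⟩ := mem_iUnion₂.1 hm
    obtain ⟨v, hv⟩ := Part.dom_iff_mem.1 ((hdom _).1 hst)
    obtain ⟨i₀, hi₀⟩ := Code.evaln_complete.1 hv
    -- As `a k < value x` strictly, long prefixes of `x` have their whole interval above `a k`; a
    -- large step count `i` makes the coded length `m` long enough.
    obtain ⟨i₁, hi₁⟩ := exists_pow_lt_of_lt_one (sub_pos.2 (hlt s.length))
      (by norm_num : (1 / 2 : ℝ) < 1)
    set i := max i₀ i₁
    set m := Nat.pair s.length (Nat.pair t.length i) with hm_def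
    have him : i ≤ m := (Nat.right_le_pair _ _).trans (Nat.right_le_pair _ _)
    have htm : t.length ≤ m := (Nat.left_le_pair _ _).trans (Nat.right_le_pair _ _)
    refine mem_iUnion₂.2 ⟨pre x m, sectionTest_iff.2 ?_, self_mem_cyl_pre x m⟩
    rw [length_pre, hm_def, Nat.unpair_pair, Nat.unpair_pair, ← hm_def]
    dsimp only
    rw [take_pre x htm, mem_cyl_iff.1 hs, mem_cyl_iff.1 ht]
    refine ⟨Option.isSome_iff_exists.2 ⟨v, Code.evaln_mono (le_max_left _ _) hi₀⟩, ?_⟩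
    have h1 := value_le x m
    rw [add_div] at h1
    have h2 : (1 : ℝ) / 2 ^ m ≤ (1 / 2) ^ i₁ := by
      rw [← one_div_pow]
      exact pow_le_pow_of_le_one (by norm_num) (by norm_num) (by omega)
    linarith

/-- Whether the right end of the interval of `t` is at most `2 ^ (-n)` above the dyadic rational
with the index `t.length`. -/
def belowTest (A E : ℕ → ℕ) (a : ℕ × List Bool) : Bool :=
  decide ((bval a.2 + 1) * (2 ^ E a.2.length * 2 ^ a.1) ≤
    (A a.2.length * 2 ^ a.1 + 2 ^ E a.2.length) * 2 ^ a.2.length)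

lemma computable_belowTest {A E : ℕ → ℕ} (hA : Computable A) (hE : Computable E) :
    Computable (belowTest A E) := by
  have hl : Computable fun a : ℕ × List Bool => a.2.length :=
    Computable.list_length.comp Computable.snd
  have hmul := Primrec.nat_mul.to_comp
  have hpow := primrec_two_pow.to_comp
  have hn : Computable fun a : ℕ × List Bool => 2 ^ a.1 := hpow.comp Computable.fst
  have hEl := hpow.comp (hE.comp hl)
  exact Primrec.nat_le.decide.to_comp.comp
    (hmul.comp (Computable.succ.comp (primrec_bval.to_comp.comp Computable.snd)) (hmul.comp hEl hn))
    (hmul.comp (Primrec.nat_add.to_comp.comp (hmul.comp (hA.comp hl) hn) hEl) (hpow.comp hl))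

lemma belowTest_iff {A E : ℕ → ℕ} {n : ℕ} {t : List Bool} : belowTest A E (n, t) = true ↔
    ((bval t : ℝ) + 1) / 2 ^ t.length ≤ (A t.length : ℝ) / 2 ^ E t.length + 1 / 2 ^ n := by
  rw [belowTest, decide_eq_true_eq, div_add_div _ _ (by positivity) (by positivity), mul_one,
    div_le_div_iff₀ (by positivity) (by positivity)]
  norm_cast

/-- The test covers much of what lies below `r`, which is harmless because `uniformAbove r` puts no
mass there. The test ignores the oracle, so `b` is arbitrary. -/
lemma not_blindRandomRel_uniformAbove {A E : ℕ → ℕ} (hA : Computable A) (hE : Computable E)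
    {x : Cantor} (hlt : ∀ k, (A k : ℝ) / 2 ^ E k < value x)
    (hlim : Tendsto (fun k => (A k : ℝ) / 2 ^ E k) atTop (𝓝 (value x))) (hx : value x < 1)
    (b : Cantor) : ¬ BlindRandomRel b (uniformAbove (value x)) x := by
  -- Shifting the levels by `c` absorbs the normalizing factor `1 / (1 - r)` of the conditional
  -- measure.
  obtain ⟨c, hc⟩ := exists_pow_lt_of_lt_one (sub_pos.2 hx) (by norm_num : (1 / 2 : ℝ) < 1)
  have hadd : Computable fun a : ℕ × List Bool => (a.1 + c, a.2) :=
    ((Primrec.nat_add.comp .fst (.const c)).pair .snd).to_comp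
  intro h
  refine h _ ⟨uniformlyEffectivelyOpenIn_of_computable _ cyl
    ((computable_belowTest hA hE).comp hadd), fun n => ?_⟩ (mem_iInter.2 fun n => ?_)
  · have hsub : value ⁻¹' Ici (value x) ∩
        (⋃ t ∈ {t | belowTest A E (n + c, t) = true}, cyl t) ⊆
        value ⁻¹' Icc (value x) (value x + 1 / 2 ^ (n + c)) := by
      rintro y ⟨hy, hyt⟩
      obtain ⟨t, ht, hyt⟩ := mem_iUnion₂.1 hyt
      have h1 := belowTest_iff.1 ht
      have h2 := value_le_of_mem hyt
      exact ⟨hy, by linarith [hlt t.length]⟩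
    have hle : fairCoin (value ⁻¹' Icc (value x) (value x + 1 / 2 ^ (n + c))) ≤
        ENNReal.ofReal (1 / 2 ^ (n + c)) := by
      rw [fairCoin_value measurableSet_Icc]
      refine (measure_mono inter_subset_left).trans_eq ?_
      rw [Real.volume_Icc, add_sub_cancel_left]
    rw [uniformAbove_eq, ProbabilityTheory.cond_apply (measurable_value measurableSet_Ici),
      fairCoin_Ici (value_nonneg x), ← ENNReal.div_eq_inv_mul]
    refine (ENNReal.div_le_div_right ((measure_mono hsub).trans hle) _).trans ?_
    rw [← ENNReal.ofReal_div_of_pos (by linarith)]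
    have : (1 : ENNReal) / 2 ^ n = ENNReal.ofReal (1 / 2 ^ n) := by
      rw [ENNReal.ofReal_div_of_pos (by positivity), ENNReal.ofReal_pow (by norm_num)]
      simp
    rw [this]
    refine ENNReal.ofReal_le_ofReal ?_
    rw [div_le_iff₀ (by linarith), pow_add, ← div_div, div_eq_mul_one_div (1 / 2 ^ n : ℝ),
      ← one_div_pow 2 c]
    exact mul_le_mul_of_nonneg_left hc.le (by positivity)
  · have h2 : Tendsto (fun l : ℕ => value x + (1 / 2 : ℝ) ^ l) atTop (𝓝 (value x + 0)) :=
      tendsto_const_nhds.add (tendsto_pow_atTop_nhds_zero_of_lt_one (by norm_num) (by norm_num))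
    have h3 := hlim.add_const (1 / 2 ^ (n + c))
    -- The length `l` serves both as precision of the prefix and as index of the approximation to
    -- `r`.
    obtain ⟨l, hl⟩ := (h2.eventually_lt h3 (by simp)).exists
    refine mem_iUnion₂.2 ⟨pre x l, belowTest_iff.2 ?_, self_mem_cyl_pre x l⟩
    have h4 := le_value x l
    rw [length_pre, add_div]
    rw [one_div_pow] at hl
    linarith

end CantorRandom

open CantorRandom
theorem mainTheorem4 :
    (∃ w : Cantor, IsOmegaNumber w) ∧
    ∀ α₂ : Cantor, IsOmegaNumber α₂ →
      ∃ (P : Measure (Cantor × Cantor)) (cond : Cantor → Measure Cantor),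
        IsProbabilityMeasure P ∧
        ComputableMeasure P ∧
        (∀ a : Cantor, IsConditionalMeasure P a (cond a)) ∧
        ∃ α₁ : Cantor,
          MLRandomPair P (α₁, α₂) ∧
          cond α₁ = uniformAbove (value α₂) ∧
          ¬ BlindRandomRel α₁ (cond α₁) α₂ := by
  refine ⟨exists_isOmegaNumber, fun x ⟨hlsc, hx⟩ => ?_⟩
  -- The endpoints `0` and `1` are the dyadic rationals `0 / 2 ^ 0` and `1 / 2 ^ 0`.
  have hpos : 0 < value x := (value_nonneg x).lt_of_ne' (by simpa using hx.value_ne 0 0)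
  have hlt1 : value x < 1 := (value_le_one x).lt_of_ne (by simpa using hx.value_ne 1 0)
  obtain ⟨A, E, hA, hE, h0, ha, hlim⟩ := hlsc.exists_strictMono hpos
  have hlt (k : ℕ) : (A k : ℝ) / 2 ^ E k < value x :=
    (ha (Nat.lt_succ_self k)).trans_le (ha.monotone.ge_of_tendsto hlim (k + 1))
  have hcond : condMeasure (fun k => (A k : ℝ) / 2 ^ E k) (value x) zeros =
      uniformAbove (value x) := by
    rw [condMeasure, dif_neg]
    simp [zeros]
  refine ⟨jointMeasure fun k => (A k : ℝ) / 2 ^ E k, condMeasure _ (value x), inferInstance,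
    computableMeasure_jointMeasure hA hE h0 ha,
    isConditionalMeasure_condMeasure ha (by simp [h0]) hlim hlt1, zeros,
    mlRandomPair_jointMeasure hA hE h0 ha hlt hx, hcond, ?_⟩
  rw [hcond]
  exact not_blindRandomRel_uniformAbove hA hE hlt hlim hlt1 zeros
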